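/- All spaces are $k$-spaces (a subset is closed if and only if its preimage under every continuous map from a compact Hausdorff space is closed); products, subspaces and pullbacks are formed in $k$-spaces. Let $G$ be a topological group (a group whose underlying space is a $k$-space, with continuous inverse and with multiplication continuous on the $k$-space product $G\times G$) that is well based, i.e. $(G,\{e\})$ is an NDR pair: there are continuous $v\colon G\to[0,1]$ and $h\colon G\times[0,1]\to G$ with $v^{-1}(0)=\{e\}$, $h(z,0)=z$, $h(e,t)=e$, and $h(z,1)=e$ whenever $v(z)<1$. Let $L\colon\Delta\to\mathbf{Grp}$ be a cosimplicial group with every $L_n$ finitely generated, with cofaces $d^i$ and codegeneracies $s^i$. For finitely generated $\Gamma$, $\mathrm{Hom}(\Gamma,G)$ has the subspace topology from $G^r$ given by $r$ generators of $\Gamma$; $\mathrm{Hom}(L,G)$ is the resulting simplicial space and $B(L,G):=|\mathrm{Hom}(L,G)|$ is its geometric realization. Let $F$ be the cosimplicial group with $F_n=\langle a_1,\dots,a_n\rangle$ free, where $d^i\colon F_{n-1}\to F_n$ sends $a_j$ to $a_j$ if $j<i$, to $a_ja_{j+1}$ if $j=i$, and to $a_{j+1}$ if $j>i$, and $s^i\colon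 F_{n+1}\to F_n$ sends $a_j$ to $a_j$ if $j\le i$, to $e$ if $j=i+1$, and to $a_{j-1}$ if $j>i+1$. An element $b\in L_1$ with $d^2(b)d^0(b)=d^1(b)$ is called a $1$-cocycle; set $b_1=b$, $b_{n+1}=d^{n+1}(b_n)$. The cosimplicial group $L^b$ has $L^b_n=\langle a_0\rangle*L_n$, where $\langle a_0\rangle$ is free on $a_0$; its operators restrict to those of $L$ on $L_n$, fix $a_0$ for all $s^i$ and for $d^i$ with $i>0$, and satisfy $d^0(a_0)=a_0b_n$ for $d^0\colon L^b_{n-1}\to L^b_n$. Let $\iota_b\colon L\hookrightarrow L^b$ be the inclusion. The group $G$ acts on $B(L^b,G)$ through left translation of the $a_0$-coordinate, $(g\rho)(a_0)=g\,\rho(a_0)$, $(g\rho)|_{L_n}=\rho|_{L_n}$. The element $a_1\in F_1$ is a $1$-cocycle of $F$; put $F^+=F^{a_1}$, $BG=B(F,G)$, $EG=B(F^+,G)$, with projection $EG\to BG$ induced by $F\hookrightarrow F^+$. Let $h_b\colon F\to L$ be a cosimplicial morphism and $b=h_b(a_1)$, a $1$-cocycle of $L$. Then: 1. With the above action, $|\iota_b^*|\colon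 B(L^b,G)\to B(L,G)$ is a principal $G$-bundle: the action is continuous, and $B(L,G)$ is covered by open sets $U$ over which there is a $G$-equivariant homeomorphism $U\times G\cong|\iota_b^*|^{-1}(U)$ over $U$. 2. This bundle is the pullback of $EG\to BG$ along $|h_b^*|\colon B(L,G)\to BG$: the map $B(L^b,G)\to EG$ induced by $\mathrm{Id}*h_b\colon F^+\to L^b$ is $G$-equivariant and covers $|h_b^*|$, and the induced map $B(L^b,G)\to B(L,G)\times_{BG}EG$ is a homeomorphism. -/

import Mathlib

universe u

namespace CosGrp

open CategoryTheory Opposite Simplicial Topology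

/-! ### Cosimplicial groups, 1-cocycles and the twisted cosimplicial group `L^b` -/

/-- A cosimplicial group is finitely generated if it is so in each degree. -/
def FinitelyGenerated (L : CosimplicialObject GrpCat.{u}) : Prop :=
  ∀ n : ℕ, Group.FG (L ^⦋n⦌)

/-- The 1-cocycles of `L`: elements `b` of `L_1` with `d^2(b) d^0(b) = d^1(b)`. -/
def Z1 (L : CosimplicialObject GrpCat.{u}) : Type u :=
  { b : L ^⦋1⦌ // L.δ (n := 1) 2 b * L.δ (n := 1) 0 b = L.δ (n := 1) 1 b }

/-- The image of a 1-cocycle under a cosimplicial morphism. -/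
def Z1.map {L M : CosimplicialObject GrpCat.{u}} (f : L ⟶ M) (b : Z1 L) : Z1 M :=
  ⟨f.app ⦋1⦌ b.1, by
    have h : ∀ i : Fin 3, M.δ i (f.app ⦋1⦌ b.1) = f.app ⦋2⦌ (L.δ i b.1) := fun i =>
      (ConcreteCategory.congr_hom (f.naturality (SimplexCategory.δ i)) b.1).symm
    rw [h, h, h, ← map_mul, b.2]⟩

/-- The morphism `[1] ⟶ [n]` with values `i ≤ j`. -/
def edge {n : SimplexCategory} (i j : Fin (n.len + 1)) (h : i ≤ j) : ⦋1⦌ ⟶ n :=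
  SimplexCategory.mkOfLe (n := n.len) i j h

lemma edge_comp {m n : SimplexCategory} (θ : m ⟶ n) (i j : Fin (m.len + 1)) (h : i ≤ j) :
    edge i j h ≫ θ = edge (θ i) (θ j) (θ.toOrderHom.monotone h) :=
  SimplexCategory.Hom.ext_one_left _ _

/-- The element of `L_n` obtained from a 1-cocycle by the coface operator `[1] ⟶ [n]` with
values `i ≤ j`. -/
def Z1.val {L : CosimplicialObject GrpCat.{u}} (b : Z1 L) {n : SimplexCategory}
    (i j : Fin (n.len + 1)) (h : i ≤ j) : L.obj n :=
  L.map (edge i j h) b.1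

lemma Z1.map_val {L : CosimplicialObject GrpCat.{u}} (b : Z1 L) {m n : SimplexCategory}
    (θ : m ⟶ n) (i j : Fin (m.len + 1)) (h : i ≤ j) :
    L.map θ (b.val i j h) = b.val (θ i) (θ j) (θ.toOrderHom.monotone h) := by
  unfold Z1.val
  rw [← edge_comp, L.map_comp]
  rfl

lemma Z1.val_mul {L : CosimplicialObject GrpCat.{u}} (b : Z1 L) {n : SimplexCategory}
    (i j k : Fin (n.len + 1)) (h : i ≤ j) (h' : j ≤ k) :
    b.val i j h * b.val j k h' = b.val i k (h.trans h') := by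
  let t : ⦋2⦌ ⟶ n := SimplexCategory.mkOfLeComp (n := n.len) i j k h h'
  have e2 : SimplexCategory.δ (n := 1) 2 ≫ t = edge i j h :=
    SimplexCategory.Hom.ext_one_left _ _
  have e0 : SimplexCategory.δ (n := 1) 0 ≫ t = edge j k h' :=
    SimplexCategory.Hom.ext_one_left _ _
  have e1 : SimplexCategory.δ (n := 1) 1 ≫ t = edge i k (h.trans h') :=
    SimplexCategory.Hom.ext_one_left _ _
  have := congrArg (L.map t) b.2
  rw [map_mul] at this
  unfold Z1.val
  rw [← e2, ← e0, ← e1, L.map_comp, L.map_comp, L.map_comp]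
  exact this

lemma Z1.val_self {L : CosimplicialObject GrpCat.{u}} (b : Z1 L) {n : SimplexCategory}
    (i : Fin (n.len + 1)) : b.val i i le_rfl = 1 := by
  have := b.val_mul i i i le_rfl le_rfl
  simpa using this

/-- The elements `b_{n+1}` of `L_{n+1}` with `b_1 = b` and `b_{k+1} = d^{k+1}(b_k)`. -/
def Z1.seq {L : CosimplicialObject GrpCat.{u}} (b : Z1 L) : (n : ℕ) → L ^⦋n + 1⦌
  | 0 => b.1
  | n + 1 => L.δ (Fin.last (n + 2)) (b.seq n)

lemma Z1.seq_eq {L : CosimplicialObject GrpCat.{u}} (b : Z1 L) (n : ℕ) :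
    b.seq n = b.val (n := ⦋n + 1⦌) (0 : Fin (n + 2)) (1 : Fin (n + 2)) (Fin.zero_le _) := by
  induction n with
  | zero =>
    have : edge (n := ⦋1⦌) (0 : Fin 2) (1 : Fin 2) (Fin.zero_le _) = 𝟙 _ :=
      SimplexCategory.Hom.ext_one_left _ _
    unfold Z1.val
    rw [this, L.map_id]
    rfl
  | succ n ih =>
    rw [Z1.seq, ih, CosimplicialObject.δ, Z1.map_val]
    congr 1

/-- The generator `a_0` of the free factor `⟨a_0⟩` of `⟨a_0⟩ ∗ Γ`. -/
def a₀ {Γ : Type u} [Group Γ] : Monoid.Coprod (FreeGroup PUnit.{u + 1}) Γ :=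
  Monoid.Coprod.inl (FreeGroup.of PUnit.unit)

/-- Homomorphisms out of `⟨a_0⟩ ∗ Γ`. -/
def liftHom {Γ H : Type u} [Group Γ] [Group H] (h : H) (f : Γ →* H) :
    Monoid.Coprod (FreeGroup PUnit.{u + 1}) Γ →* H :=
  Monoid.Coprod.lift (FreeGroup.lift fun _ => h) f

@[simp] lemma liftHom_a₀ {Γ H : Type u} [Group Γ] [Group H] (h : H) (f : Γ →* H) :
    liftHom h f a₀ = h := by
  simp [liftHom, a₀]

@[simp] lemma liftHom_inr {Γ H : Type u} [Group Γ] [Group H] (h : H) (f : Γ →* H) (x : Γ) :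
    liftHom h f (Monoid.Coprod.inr x) = f x := by
  simp [liftHom]

lemma coprod_hom_ext {Γ H : Type u} [Group Γ] [Group H]
    {f g : Monoid.Coprod (FreeGroup PUnit.{u + 1}) Γ →* H} (h₀ : f a₀ = g a₀)
    (h₁ : ∀ x : Γ, f (Monoid.Coprod.inr x) = g (Monoid.Coprod.inr x)) : f = g := by
  apply Monoid.Coprod.hom_ext
  · ext
    exact h₀
  · ext x
    exact h₁ x

/-- The operators of `L^b`: `θ : [m] ⟶ [n]` acts on `L_m` as in `L`, and sends `a_0` to `a_0 x`, where
`x` is the image of `b` under the operator `[1] ⟶ [n]` with values `0, θ(0)`. -/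
def twistOp (L : CosimplicialObject GrpCat.{u}) (b : Z1 L) {m n : SimplexCategory} (θ : m ⟶ n) :
    Monoid.Coprod (FreeGroup PUnit.{u + 1}) (L.obj m) →*
      Monoid.Coprod (FreeGroup PUnit.{u + 1}) (L.obj n) :=
  liftHom (a₀ * Monoid.Coprod.inr (b.val 0 (θ 0) (Fin.zero_le _)))
    (Monoid.Coprod.inr.comp (L.map θ).hom)

/-- The cosimplicial group `L^b`, with `(L^b)_n = ⟨a_0⟩ ∗ L_n`. On the factors `L_n` the
operators are those of `L`; on `a_0` they are `d^0(a_0) = a_0 b_{n+1}` (`twist_δ_zero`),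
`d^i(a_0) = a_0` for `i > 0` (`twist_δ_succ`) and `s^i(a_0) = a_0` (`twist_σ`). -/
def twist (L : CosimplicialObject GrpCat.{u}) (b : Z1 L) : CosimplicialObject GrpCat.{u} where
  obj n := GrpCat.of (Monoid.Coprod (FreeGroup PUnit.{u + 1}) (L.obj n))
  map θ := GrpCat.ofHom (twistOp L b θ)
  map_id n := by
    apply GrpCat.hom_ext
    apply coprod_hom_ext
    · change liftHom _ _ a₀ = a₀
      rw [liftHom_a₀]
      have : b.val (n := n) 0 ((𝟙 n : n ⟶ n) 0) (Fin.zero_le _) = 1 := b.val_self 0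
      rw [this]
      simp
    · intro x
      change liftHom _ _ _ = Monoid.Coprod.inr x
      rw [liftHom_inr, L.map_id]
      rfl
  map_comp {l m n} θ φ := by
    apply GrpCat.hom_ext
    apply coprod_hom_ext
    · change twistOp L b (θ ≫ φ) a₀ = twistOp L b φ (twistOp L b θ a₀)
      unfold twistOp
      rw [liftHom_a₀, liftHom_a₀, map_mul, liftHom_a₀, liftHom_inr]
      change _ = a₀ * Monoid.Coprod.inr _ * Monoid.Coprod.inr (L.map φ _)
      rw [Z1.map_val, mul_assoc, ← map_mul, Z1.val_mul]
      rfl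
    · intro x
      change Monoid.Coprod.inr (L.map (θ ≫ φ) x) = Monoid.Coprod.inr (L.map φ (L.map θ x))
      rw [L.map_comp]
      rfl

variable (L : CosimplicialObject GrpCat.{u}) (b : Z1 L)

lemma twist_map_inr {m n : SimplexCategory} (θ : m ⟶ n) (x : L.obj m) :
    (twist L b).map θ (Monoid.Coprod.inr x : Monoid.Coprod (FreeGroup PUnit.{u + 1}) (L.obj m)) =
      (Monoid.Coprod.inr (L.map θ x) : Monoid.Coprod (FreeGroup PUnit.{u + 1}) (L.obj n)) :=
  liftHom_inr _ _ _

lemma twist_map_a₀ {m n : SimplexCategory} (θ : m ⟶ n) :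
    (twist L b).map θ (a₀ : Monoid.Coprod (FreeGroup PUnit.{u + 1}) (L.obj m)) =
      (a₀ * Monoid.Coprod.inr (b.val 0 (θ 0) (Fin.zero_le _)) :
        Monoid.Coprod (FreeGroup PUnit.{u + 1}) (L.obj n)) :=
  liftHom_a₀ _ _

lemma twist_δ_zero (n : ℕ) :
    (twist L b).δ (n := n) 0 (a₀ : Monoid.Coprod (FreeGroup PUnit.{u + 1}) (L ^⦋n⦌)) =
      (a₀ * Monoid.Coprod.inr (b.seq n) :
        Monoid.Coprod (FreeGroup PUnit.{u + 1}) (L ^⦋n + 1⦌)) := by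
  rw [Z1.seq_eq]
  exact twist_map_a₀ L b (SimplexCategory.δ 0)

lemma twist_δ_succ (n : ℕ) (i : Fin (n + 1)) :
    (twist L b).δ i.succ (a₀ : Monoid.Coprod (FreeGroup PUnit.{u + 1}) (L ^⦋n⦌)) =
      (a₀ : Monoid.Coprod (FreeGroup PUnit.{u + 1}) (L ^⦋n + 1⦌)) := by
  refine (twist_map_a₀ L b (SimplexCategory.δ i.succ)).trans ?_
  have : ∀ j : Fin (n + 2), j = 0 →
      b.val (n := ⦋n + 1⦌) (0 : Fin (n + 2)) j (Fin.zero_le _) = 1 := by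
    rintro _ rfl
    exact b.val_self _
  have h0 : (i.succ.succAbove (0 : Fin (n + 1)) : Fin (n + 2)) = 0 :=
    Fin.succAbove_ne_zero_zero (Fin.succ_ne_zero i)
  exact (congrArg (fun x : L ^⦋n + 1⦌ => (a₀ * Monoid.Coprod.inr x :
    Monoid.Coprod (FreeGroup PUnit.{u + 1}) (L ^⦋n + 1⦌))) (this _ h0)).trans (by simp)

lemma twist_σ (n : ℕ) (i : Fin (n + 1)) :
    (twist L b).σ i (a₀ : Monoid.Coprod (FreeGroup PUnit.{u + 1}) (L ^⦋n + 1⦌)) =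
      (a₀ : Monoid.Coprod (FreeGroup PUnit.{u + 1}) (L ^⦋n⦌)) := by
  refine (twist_map_a₀ L b (SimplexCategory.σ i)).trans ?_
  have : ∀ j : Fin (n + 1), j = 0 →
      b.val (n := ⦋n⦌) (0 : Fin (n + 1)) j (Fin.zero_le _) = 1 := by
    rintro _ rfl
    exact b.val_self _
  have h0 : (i.predAbove (0 : Fin (n + 2)) : Fin (n + 1)) = 0 := Fin.predAbove_right_zero
  exact (congrArg (fun x : L ^⦋n⦌ => (a₀ * Monoid.Coprod.inr x :
    Monoid.Coprod (FreeGroup PUnit.{u + 1}) (L ^⦋n⦌))) (this _ h0)).trans (by simp)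

/-- The canonical inclusion `ι_b : L ⟶ L^b`. -/
def incl : L ⟶ twist L b where
  app n := GrpCat.ofHom (Monoid.Coprod.inr :
    L.obj n →* Monoid.Coprod (FreeGroup PUnit.{u + 1}) (L.obj n))
  naturality m n θ := by
    ext x
    exact (twist_map_inr L b θ x).symm

variable {L} in
/-- The morphism `Id ∗ f : L^b ⟶ M^{f(b)}` induced by a cosimplicial morphism `f : L ⟶ M`. -/
def twistMap {M : CosimplicialObject GrpCat.{u}} (f : L ⟶ M) :
    twist L b ⟶ twist M (b.map f) where
  app n := GrpCat.ofHom (Monoid.Coprod.map (MonoidHom.id (FreeGroup PUnit.{u + 1}))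
    (f.app n).hom)
  naturality m n θ := by
    have nat : ∀ {m n : SimplexCategory} (θ : m ⟶ n) (x : L.obj m),
        f.app n (L.map θ x) = M.map θ (f.app m x) := fun θ x =>
      ConcreteCategory.congr_hom (f.naturality θ) x
    apply GrpCat.hom_ext
    apply coprod_hom_ext
    · change Monoid.Coprod.map _ _ ((twist L b).map θ
        (a₀ : Monoid.Coprod (FreeGroup PUnit.{u + 1}) (L.obj m))) = (twist M (b.map f)).map θ
          (a₀ : Monoid.Coprod (FreeGroup PUnit.{u + 1}) (M.obj m))
      rw [twist_map_a₀, twist_map_a₀, map_mul]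
      change a₀ * Monoid.Coprod.inr _ = _
      congr 2
      exact nat (edge _ _ _) b.1
    · intro x
      change Monoid.Coprod.map _ _ ((twist L b).map θ
        (Monoid.Coprod.inr x : Monoid.Coprod (FreeGroup PUnit.{u + 1}) (L.obj m))) =
          (twist M (b.map f)).map θ (Monoid.Coprod.inr (f.app m x) :
            Monoid.Coprod (FreeGroup PUnit.{u + 1}) (M.obj m))
      rw [twist_map_inr, twist_map_inr]
      change Monoid.Coprod.inr _ = _
      congr 1
      exact nat θ x

/-! ### The free cosimplicial group `F` -/

/-- The generator `a_{k+1}` of the free group `F_n = ⟨a_1, …, a_n⟩`, for `k < n`. -/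
def gen {n : ℕ} (k : Fin n) : FreeGroup (ULift.{u} (Fin n)) := FreeGroup.of ⟨k⟩

/-- The product `a_1 a_2 ⋯ a_i` in `F_n` (for `i ≤ n`). -/
def initProd (n i : ℕ) : FreeGroup (ULift.{u} (Fin n)) := match i with
  | 0 => 1
  | i + 1 => initProd n i * (if h : i < n then gen ⟨i, h⟩ else 1)

/-- For monotone `θ : [m] → [n]`, the homomorphism `F_m → F_n` sending `a_j` to
`a_{θ(j-1)+1} a_{θ(j-1)+2} ⋯ a_{θ(j)}`, written as a quotient of two initial products. -/
def freeMap {m n : ℕ} (θ : Fin (m + 1) → Fin (n + 1)) :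
    FreeGroup (ULift.{u} (Fin m)) →* FreeGroup (ULift.{u} (Fin n)) :=
  FreeGroup.lift fun k =>
    (initProd n (θ k.down.castSucc))⁻¹ * initProd n (θ k.down.succ)

lemma freeMap_gen {m n : ℕ} (θ : Fin (m + 1) → Fin (n + 1)) (k : Fin m) :
    freeMap.{u} θ (gen k) = (initProd n (θ k.castSucc))⁻¹ * initProd n (θ k.succ) := by
  simp [freeMap, gen]

lemma freeMap_initProd {m n : ℕ} (θ : Fin (m + 1) → Fin (n + 1)) (i : Fin (m + 1)) :
    freeMap.{u} θ (initProd m i) = (initProd n (θ 0))⁻¹ * initProd n (θ i) := by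
  obtain ⟨i, hi⟩ := i
  induction i with
  | zero => simp [initProd]
  | succ i ih =>
    have hi' : i < m := by omega
    have := ih (by omega)
    simp only at this ⊢
    rw [initProd, map_mul, this, dif_pos hi', freeMap_gen]
    simp only [Fin.castSucc_mk, Fin.succ_mk]
    group

/-- The cosimplicial group `F` with `F_n = ⟨a_1, …, a_n⟩` free; the lemmas `free_δ_lt`, `free_δ_eq`,
`free_δ_gt`, `free_σ_lt`, `free_σ_eq`, `free_σ_gt` give its cofaces and codegeneracies. -/
def free : CosimplicialObject GrpCat.{u} where
  obj n := GrpCat.of (FreeGroup (ULift.{u} (Fin n.len)))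
  map θ := GrpCat.ofHom (freeMap θ)
  map_id n := by
    apply GrpCat.hom_ext
    apply FreeGroup.ext_hom
    rintro ⟨k⟩
    change freeMap _ (gen k) = gen k
    rw [freeMap_gen]
    change (initProd _ (k : ℕ))⁻¹ * initProd _ ((k : ℕ) + 1) = _
    simp [initProd]
  map_comp {l m n} θ φ := by
    apply GrpCat.hom_ext
    apply FreeGroup.ext_hom
    rintro ⟨k⟩
    change freeMap _ (gen k) = freeMap φ (freeMap θ (gen k))
    rw [freeMap_gen, freeMap_gen, map_mul, map_inv, freeMap_initProd, freeMap_initProd]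
    change (initProd _ (φ (θ _)))⁻¹ * initProd _ (φ (θ _)) = _
    group

lemma initProd_succ {n : ℕ} (k : Fin n) :
    initProd.{u} n ((k : ℕ) + 1) = initProd n k * gen k := by
  simp [initProd]

lemma free_map_gen {m n : ℕ} (θ : ⦋m⦌ ⟶ ⦋n⦌) (k : Fin m) (p q : ℕ)
    (hp : ((θ k.castSucc : Fin (n + 1)) : ℕ) = p) (hq : ((θ k.succ : Fin (n + 1)) : ℕ) = q) :
    free.{u}.map θ (gen k : FreeGroup (ULift.{u} (Fin m))) =
      ((initProd n p)⁻¹ * initProd n q : FreeGroup (ULift.{u} (Fin n))) := by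
  subst hp hq
  exact freeMap_gen _ _

lemma free_δ_lt {n : ℕ} (i : Fin (n + 2)) (k : Fin n) (h : (k : ℕ) + 1 < i) :
    free.{u}.δ i (gen k : FreeGroup (ULift.{u} (Fin n))) =
      (gen k.castSucc : FreeGroup (ULift.{u} (Fin (n + 1)))) := by
  refine (free_map_gen (SimplexCategory.δ i) k k (k + 1) ?_ ?_).trans ?_
  · change ((i.succAbove k.castSucc : Fin (n + 2)) : ℕ) = _
    rw [Fin.succAbove_of_castSucc_lt _ _ (by simp [Fin.lt_def]; omega)]; simp
  · change ((i.succAbove k.succ : Fin (n + 2)) : ℕ) = _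
    rw [Fin.succAbove_of_castSucc_lt _ _ (by simpa [Fin.lt_def] using h)]; simp
  · have := initProd_succ.{u} k.castSucc
    simp only [Fin.val_castSucc] at this
    rw [this]; simp; rfl

lemma free_δ_eq {n : ℕ} (i : Fin (n + 2)) (k : Fin n) (h : (k : ℕ) + 1 = i) :
    free.{u}.δ i (gen k : FreeGroup (ULift.{u} (Fin n))) =
      (gen k.castSucc * gen k.succ : FreeGroup (ULift.{u} (Fin (n + 1)))) := by
  refine (free_map_gen (SimplexCategory.δ i) k k (k + 1 + 1) ?_ ?_).trans ?_
  · change ((i.succAbove k.castSucc : Fin (n + 2)) : ℕ) = _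
    rw [Fin.succAbove_of_castSucc_lt _ _ (by simp [Fin.lt_def]; omega)]; simp
  · change ((i.succAbove k.succ : Fin (n + 2)) : ℕ) = _
    rw [Fin.succAbove_of_le_castSucc _ _ (by simp [Fin.le_def]; omega)]; simp
  · have h1 := initProd_succ.{u} k.castSucc
    have h2 := initProd_succ.{u} k.succ
    simp only [Fin.val_castSucc, Fin.val_succ] at h1 h2
    rw [h2, h1]; simp [mul_assoc]; rfl

lemma free_δ_gt {n : ℕ} (i : Fin (n + 2)) (k : Fin n) (h : (i : ℕ) < k + 1) :
    free.{u}.δ i (gen k : FreeGroup (ULift.{u} (Fin n))) =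
      (gen k.succ : FreeGroup (ULift.{u} (Fin (n + 1)))) := by
  refine (free_map_gen (SimplexCategory.δ i) k (k + 1) (k + 1 + 1) ?_ ?_).trans ?_
  · change ((i.succAbove k.castSucc : Fin (n + 2)) : ℕ) = _
    rw [Fin.succAbove_of_le_castSucc _ _ (by simp [Fin.le_def]; omega)]; simp
  · change ((i.succAbove k.succ : Fin (n + 2)) : ℕ) = _
    rw [Fin.succAbove_of_le_castSucc _ _ (by simp [Fin.le_def]; omega)]; simp
  · have h2 := initProd_succ.{u} k.succ
    simp only [Fin.val_succ] at h2
    rw [h2]; simp; rfl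

lemma free_σ_lt {n : ℕ} (i : Fin (n + 1)) (k : Fin (n + 1)) (h : (k : ℕ) < i) :
    free.{u}.σ i (gen k : FreeGroup (ULift.{u} (Fin (n + 1)))) =
      (gen ⟨k, by omega⟩ : FreeGroup (ULift.{u} (Fin n))) := by
  refine (free_map_gen (SimplexCategory.σ i) k k (k + 1) ?_ ?_).trans ?_
  · change ((i.predAbove k.castSucc : Fin (n + 1)) : ℕ) = _
    rw [Fin.predAbove_of_le_castSucc i k.castSucc
      (by rw [Fin.le_def]; simpa using h.le)]; simp
  · change ((i.predAbove k.succ : Fin (n + 1)) : ℕ) = _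
    rw [Fin.predAbove_of_le_castSucc i k.succ (by rw [Fin.le_def]; simpa using h)]; simp
  · have h2 := initProd_succ.{u} (⟨k, by omega⟩ : Fin n)
    simp only at h2
    rw [h2]; simp; rfl

lemma free_σ_eq {n : ℕ} (i : Fin (n + 1)) :
    free.{u}.σ i (gen i : FreeGroup (ULift.{u} (Fin (n + 1)))) =
      (1 : FreeGroup (ULift.{u} (Fin n))) := by
  refine (free_map_gen (SimplexCategory.σ i) i i i ?_ ?_).trans ?_
  · change ((i.predAbove i.castSucc : Fin (n + 1)) : ℕ) = _
    rw [Fin.predAbove_of_le_castSucc _ _ (by simp)]; simp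
  · change ((i.predAbove i.succ : Fin (n + 1)) : ℕ) = _
    rw [Fin.predAbove_of_castSucc_lt _ _ (by simp [Fin.lt_def])]; simp
  · simp; rfl

lemma free_σ_gt {n : ℕ} (i : Fin (n + 1)) (k : Fin n) (h : (i : ℕ) < k + 1) :
    free.{u}.σ i (gen k.succ : FreeGroup (ULift.{u} (Fin (n + 1)))) =
      (gen k : FreeGroup (ULift.{u} (Fin n))) := by
  refine (free_map_gen (SimplexCategory.σ i) k.succ k (k + 1) ?_ ?_).trans ?_
  · change ((i.predAbove k.succ.castSucc : Fin (n + 1)) : ℕ) = _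
    rw [Fin.predAbove_of_castSucc_lt _ _ (by simp [Fin.lt_def]; omega)]; simp
  · change ((i.predAbove k.succ.succ : Fin (n + 1)) : ℕ) = _
    rw [Fin.predAbove_of_castSucc_lt _ _ (by simp [Fin.lt_def]; omega)]; simp
  · rw [initProd_succ]; simp; rfl

/-- The 1-cocycle `a_1` of `F`. -/
def a₁ : Z1 free.{u} :=
  ⟨(gen 0 : FreeGroup (ULift.{u} (Fin 1))), by
    rw [free_δ_lt 2 0 (by decide), free_δ_gt 0 0 (by decide), free_δ_eq 1 0 (by decide)]
    rfl⟩

/-- The 1-cocycle `b = h(a_1)` of a cosimplicial morphism `h : F ⟶ L`. -/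
def cocycle {L : CosimplicialObject GrpCat.{u}} (h : free.{u} ⟶ L) : Z1 L := a₁.map h

/-! ### `k`-spaces -/

/-- The `k`-space underlying a space `Y`: the same set, in which a subset is closed if and only if
its preimage under every continuous map from a compact Hausdorff space to `Y` is closed. -/
abbrev Kify (Y : Type u) [TopologicalSpace Y] : Type u :=
  WithGeneratedByTopology (fun K : CompHaus.{u} => (K : Type u)) Y

/-- A point of `Y` as a point of `Kify Y`. -/
abbrev Kify.mk {Y : Type u} [TopologicalSpace Y] (y : Y) : Kify Y :=
  WithGeneratedByTopology.equiv.symm y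

/-- A point of `Kify Y` as a point of `Y`. -/
abbrev Kify.val {Y : Type u} [TopologicalSpace Y] (y : Kify Y) : Y :=
  WithGeneratedByTopology.equiv y

/-- The group operations of `G` are continuous in the category of `k`-spaces, in which the product
of `X` and `Y` is `Kify (X × Y)`. -/
class IsKGroup (G : Type u) [Group G] [TopologicalSpace G] : Prop where
  continuous_mul : Continuous fun p : Kify (G × G) => p.val.1 * p.val.2
  continuous_inv : Continuous fun g : G => g⁻¹

instance (G : Type u) [Group G] [TopologicalSpace G] [IsTopologicalGroup G] : IsKGroup G where
  continuous_mul := continuous_mul.comp WithGeneratedByTopology.continuous_equiv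
  continuous_inv := continuous_inv

lemma IsKGroup.continuous_mul_of_compHaus {G : Type u} [Group G] [TopologicalSpace G] [IsKGroup G]
    {K : CompHaus.{u}} {f g : K → G} (hf : Continuous f) (hg : Continuous g) :
    Continuous fun x => f x * g x :=
  (WithGeneratedByTopology.continuous_from_iff _).1 (IsKGroup.continuous_mul (G := G))
    (i := K) ⟨fun x => (f x, g x), hf.prodMk hg⟩

/-- `(Z, A)` is an NDR pair. -/
def IsNDRPair {Z : Type u} [TopologicalSpace Z] (A : Set Z) : Prop :=
  ∃ (h : C(Z × unitInterval, Z)) (v : C(Z, unitInterval)),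
    A = v ⁻¹' {0} ∧ (∀ z, h (z, 0) = z) ∧ (∀ a ∈ A, ∀ t, h (a, t) = a) ∧
      ∀ z, v z < 1 → h (z, 1) ∈ A

/-- `G` is well based: its identity element is a nondegenerate base point. -/
def WellBased (G : Type u) [Group G] [TopologicalSpace G] : Prop :=
  IsNDRPair ({1} : Set G)

/-! ### Spaces of homomorphisms and geometric realization -/

/-- The set of homomorphisms `Γ → G`, with the topology of pointwise convergence. -/
def PtHom (Γ G : Type u) [Group Γ] [Group G] : Type u := Γ →* G

instance (Γ G : Type u) [Group Γ] [Group G] : FunLike (PtHom Γ G) Γ G :=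
  inferInstanceAs (FunLike (Γ →* G) Γ G)

instance (Γ G : Type u) [Group Γ] [Group G] : MonoidHomClass (PtHom Γ G) Γ G :=
  inferInstanceAs (MonoidHomClass (Γ →* G) Γ G)

instance (Γ G : Type u) [Group Γ] [Group G] [TopologicalSpace G] : TopologicalSpace (PtHom Γ G) :=
  TopologicalSpace.induced (fun (ρ : PtHom Γ G) (x : Γ) => ρ x) inferInstance

/-- The `k`-space `Hom(Γ, G)`. For finitely generated `Γ` its topology is the subspace topology
from `G^r`, formed in `k`-spaces: see `HomSpace.topology_eq_of_generators`. -/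
abbrev HomSpace (Γ G : Type u) [Group Γ] [Group G] [TopologicalSpace G] : Type u :=
  Kify (PtHom Γ G)

lemma generatedBy_le_generatedBy {Y : Type u} (t₁ t₂ : TopologicalSpace Y)
    (h : ∀ (K : CompHaus.{u}) (f : K → Y), Continuous[inferInstance, t₁] f →
      Continuous[inferInstance, t₂] f) :
    t₁.generatedBy (fun K : CompHaus.{u} => (K : Type u)) ≤
      t₂.generatedBy (fun K : CompHaus.{u} => (K : Type u)) := by
  unfold TopologicalSpace.generatedBy
  refine iSup₂_le fun K f => ?_
  have hf : Continuous[inferInstance, t₂] (@ContinuousMap.toFun _ _ _ t₁ f) :=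
    h K _ (@ContinuousMap.continuous_toFun _ _ _ t₁ f)
  exact (le_iSup (fun f : @ContinuousMap K Y _ t₂ => TopologicalSpace.coinduced
    (@ContinuousMap.toFun _ _ _ t₂ f) inferInstance) (@ContinuousMap.mk _ _ _ t₂ _ hf)).trans
    (le_iSup (fun K : CompHaus.{u} => ⨆ f : @ContinuousMap K Y _ t₂, TopologicalSpace.coinduced
      (@ContinuousMap.toFun _ _ _ t₂ f) inferInstance) K)

lemma HomSpace.topology_eq_of_generators {Γ G : Type u} [Group Γ] [Group G] [TopologicalSpace G]
    [IsKGroup G] {r : ℕ} (s : Fin r → Γ) (hs : Subgroup.closure (Set.range s) = ⊤) :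
    (inferInstance : TopologicalSpace (PtHom Γ G)).generatedBy
        (fun K : CompHaus.{u} => (K : Type u)) =
      (TopologicalSpace.induced (fun (ρ : PtHom Γ G) (i : Fin r) => ρ (s i))
        inferInstance).generatedBy (fun K : CompHaus.{u} => (K : Type u)) := by
  apply le_antisymm <;> refine generatedBy_le_generatedBy _ _ fun K f hf => ?_
  · have hf' := continuous_induced_rng.1 hf
    exact continuous_induced_rng.2 (continuous_pi fun i => (continuous_apply (s i)).comp hf')
  · have hf' := continuous_induced_rng.1 hf
    refine continuous_induced_rng.2 (continuous_pi fun x => ?_)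
    change Continuous fun k => f k x
    have hx : x ∈ Subgroup.closure (Set.range s) := hs ▸ Subgroup.mem_top x
    induction hx using Subgroup.closure_induction with
    | mem x hx =>
      obtain ⟨i, rfl⟩ := hx
      exact (continuous_apply i).comp hf'
    | one => simpa using continuous_const
    | mul x y _ _ hx hy =>
      simp only [map_mul]
      exact IsKGroup.continuous_mul_of_compHaus hx hy
    | inv x _ hx =>
      simp only [map_inv]
      exact IsKGroup.continuous_inv.comp hx

/-- Precomposition `φ^* : Hom(Γ', G) → Hom(Γ, G)`. -/
def PtHom.comap {Γ Γ' : Type u} (G : Type u) [Group Γ] [Group Γ'] [Group G] [TopologicalSpace G]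
    (φ : Γ →* Γ') : C(PtHom Γ' G, PtHom Γ G) where
  toFun ρ := MonoidHom.comp ρ φ
  continuous_toFun := continuous_induced_rng.2 (continuous_pi fun x =>
    (continuous_apply (φ x)).comp continuous_induced_dom)

/-- Precomposition `φ^* : Hom(Γ', G) → Hom(Γ, G)`, as a map of `k`-spaces. -/
def HomSpace.comap {Γ Γ' : Type u} (G : Type u) [Group Γ] [Group Γ'] [Group G]
    [TopologicalSpace G] (φ : Γ →* Γ') : C(HomSpace Γ' G, HomSpace Γ G) :=
  (PtHom.comap G φ).continuous.continuousGeneratedBy.continuousMap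

/-- The simplicial space `Hom(L, G)`. -/
def homSpace (L : CosimplicialObject GrpCat.{u}) (G : Type u) [Group G] [TopologicalSpace G] :
    SimplicialObject TopCat.{u} where
  obj n := TopCat.of (HomSpace (L.obj n.unop) G)
  map θ := TopCat.ofHom (HomSpace.comap G (L.map θ.unop).hom)
  map_id n := by
    ext (ρ : HomSpace (L.obj _) G)
    refine DFunLike.ext (F := PtHom (L.obj _) G) _ _ fun x => ?_
    change ρ.val (L.map (𝟙 _) x) = ρ.val x
    rw [L.map_id]
    rfl
  map_comp θ φ := by
    ext (ρ : HomSpace (L.obj _) G)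
    refine DFunLike.ext (F := PtHom (L.obj _) G) _ _ fun x => ?_
    change ρ.val (L.map (φ.unop ≫ θ.unop) x) = ρ.val (L.map _ (L.map _ x))
    rw [L.map_comp]
    rfl

/-- The simplicial map `f^* : Hom(M, G) ⟶ Hom(L, G)` of a cosimplicial morphism `f : L ⟶ M`. -/
def homSpaceMap {L M : CosimplicialObject GrpCat.{u}} (f : L ⟶ M) (G : Type u) [Group G]
    [TopologicalSpace G] : homSpace M G ⟶ homSpace L G where
  app n := TopCat.ofHom (HomSpace.comap G (f.app n.unop).hom)
  naturality m n θ := by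
    ext (ρ : HomSpace (M.obj _) G)
    refine DFunLike.ext (F := PtHom (L.obj _) G) _ _ fun x => ?_
    change ρ.val (M.map θ.unop (f.app _ x)) = ρ.val (f.app _ (L.map θ.unop x))
    exact congrArg (fun y => ρ.val y) (ConcreteCategory.congr_hom (f.naturality θ.unop) x).symm

/-- The disjoint union of the spaces `X_n × Δ^n`. (If the `X_n` are `k`-spaces, then so are these
products, as `Δ^n` is compact Hausdorff.) -/
abbrev PreRealization (X : SimplicialObject TopCat.{u}) : Type u :=
  Σ n : SimplexCategory, (X.obj (op n) : Type u) × (SimplexCategory.toTop₀.obj n : Type)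

/-- The gluing relation `(θ^* x, t) ∼ (x, θ_* t)` of the geometric realization. -/
inductive RealizationRel (X : SimplicialObject TopCat.{u}) :
    PreRealization X → PreRealization X → Prop where
  | glue {m n : SimplexCategory} (θ : m ⟶ n) (x : X.obj (op n)) (t : SimplexCategory.toTop₀.obj m) :
      RealizationRel X ⟨m, X.map θ.op x, t⟩ ⟨n, x, SimplexCategory.toTop₀.map θ t⟩

lemma RealizationRel.of_eq {X : SimplicialObject TopCat.{u}} {m n : SimplexCategory} (θ : m ⟶ n)
    (x : X.obj (op n)) (y : X.obj (op m)) (t : SimplexCategory.toTop₀.obj m)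
    (h : y = X.map θ.op x) :
    RealizationRel X ⟨m, y, t⟩ ⟨n, x, SimplexCategory.toTop₀.map θ t⟩ := by
  subst h
  exact .glue θ x t

/-- The geometric realization `|X|` of a simplicial space, with the quotient topology. -/
def Realization (X : SimplicialObject TopCat.{u}) : Type u := Quot (RealizationRel X)

instance (X : SimplicialObject TopCat.{u}) : TopologicalSpace (Realization X) :=
  inferInstanceAs (TopologicalSpace (Quot (RealizationRel X)))

/-- The map `|X| → |Y|` induced by a simplicial map. -/
def Realization.map {X Y : SimplicialObject TopCat.{u}} (f : X ⟶ Y) :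
    C(Realization X, Realization Y) where
  toFun := Quot.map (fun p => ⟨p.1, f.app (op p.1) p.2.1, p.2.2⟩) (by
    rintro _ _ ⟨θ, x, t⟩
    have := ConcreteCategory.congr_hom (f.naturality θ.op) x
    simp only [TopCat.comp_app] at this
    dsimp only
    rw [this]
    exact RealizationRel.glue θ _ t)
  continuous_toFun := by
    refine continuous_quot_lift _ ?_
    refine continuous_quot_mk.comp ?_
    refine continuous_sigma fun n => ?_
    exact continuous_sigmaMk.comp
      (((f.app (op n)).hom.continuous.comp continuous_fst).prodMk continuous_snd)

/-- `B(L, G) = |Hom(L, G)|`. -/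
def B (L : CosimplicialObject GrpCat.{u}) (G : Type u) [Group G] [TopologicalSpace G] : Type u :=
  Realization (homSpace L G)

instance (L : CosimplicialObject GrpCat.{u}) (G : Type u) [Group G] [TopologicalSpace G] :
    TopologicalSpace (B L G) :=
  inferInstanceAs (TopologicalSpace (Realization (homSpace L G)))

/-- The map `|f^*| : B(M, G) → B(L, G)` of a cosimplicial morphism `f : L ⟶ M`. -/
def B.comap {L M : CosimplicialObject GrpCat.{u}} (f : L ⟶ M) (G : Type u) [Group G]
    [TopologicalSpace G] : C(B M G, B L G) :=
  Realization.map (homSpaceMap f G)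

/-- `BG = |NG| = B(F, G)`. -/
abbrev BG (G : Type u) [Group G] [TopologicalSpace G] : Type u := B free.{u} G

/-- Steenrod's model `EG = B(F^+, G)`, where `F^+ = F^{a_1}`. -/
abbrev EG (G : Type u) [Group G] [TopologicalSpace G] : Type u := B (twist free.{u} a₁) G

/-- The projection `EG → BG` induced by the inclusion `F ⟶ F^+`. -/
def EGproj (G : Type u) [Group G] [TopologicalSpace G] : C(EG G, BG G) :=
  B.comap (incl free.{u} a₁) G

/-! ### The action of `G` on `B(L^b, G)` -/

/-- Left translation of the coordinate `a_0`: `(g ρ)(a_0) = g ρ(a_0)`, and `g ρ = ρ` on `Γ`. -/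
def translate {Γ G : Type u} [Group Γ] [Group G] (g : G)
    (ρ : Monoid.Coprod (FreeGroup PUnit.{u + 1}) Γ →* G) :
    Monoid.Coprod (FreeGroup PUnit.{u + 1}) Γ →* G :=
  liftHom (g * ρ a₀) (ρ.comp Monoid.Coprod.inr)

lemma translate_one {Γ G : Type u} [Group Γ] [Group G]
    (ρ : Monoid.Coprod (FreeGroup PUnit.{u + 1}) Γ →* G) : translate 1 ρ = ρ := by
  apply coprod_hom_ext <;> simp [translate]

lemma translate_mul {Γ G : Type u} [Group Γ] [Group G] (g g' : G)
    (ρ : Monoid.Coprod (FreeGroup PUnit.{u + 1}) Γ →* G) :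
    translate (g * g') ρ = translate g (translate g' ρ) := by
  apply coprod_hom_ext <;> simp [translate, mul_assoc]

lemma translate_comp {G : Type u} [Group G] {m n : SimplexCategory} (θ : m ⟶ n) (g : G)
    (ρ : Monoid.Coprod (FreeGroup PUnit.{u + 1}) (L.obj n) →* G) :
    translate g (ρ.comp ((twist L b).map θ).hom) =
      (translate g ρ).comp ((twist L b).map θ).hom := by
  apply coprod_hom_ext
  · change translate g (ρ.comp ((twist L b).map θ).hom) a₀ =
      translate g ρ ((twist L b).map θ (a₀ : Monoid.Coprod (FreeGroup PUnit.{u + 1}) (L.obj m)))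
    rw [twist_map_a₀, translate, liftHom_a₀, translate, map_mul, liftHom_a₀, liftHom_inr]
    change g * ρ ((twist L b).map θ
      (a₀ : Monoid.Coprod (FreeGroup PUnit.{u + 1}) (L.obj m))) = _
    rw [twist_map_a₀, map_mul, mul_assoc]
    rfl
  · intro x
    change translate g (ρ.comp ((twist L b).map θ).hom) (Monoid.Coprod.inr x) =
      translate g ρ ((twist L b).map θ
        (Monoid.Coprod.inr x : Monoid.Coprod (FreeGroup PUnit.{u + 1}) (L.obj m)))
    rw [twist_map_inr, translate, liftHom_inr, translate, liftHom_inr]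
    change ρ ((twist L b).map θ
      (Monoid.Coprod.inr x : Monoid.Coprod (FreeGroup PUnit.{u + 1}) (L.obj m))) = _
    rw [twist_map_inr]
    rfl

/-- The action of `G` on `B(L^b, G)`, induced by the simplicial action on `Hom(L^b, G)` by left
translation of the coordinate `a_0`. -/
instance (G : Type u) [Group G] [TopologicalSpace G] : MulAction G (B (twist L b) G) where
  smul g := Quot.map (ra := RealizationRel (homSpace (twist L b) G))
    (rb := RealizationRel (homSpace (twist L b) G))
    (fun p => ⟨p.1, translate (Γ := L.obj p.1) g p.2.1, p.2.2⟩) (by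
      rintro _ _ ⟨θ, ρ, t⟩
      exact RealizationRel.of_eq θ _ _ t (translate_comp L b θ g ρ))
  one_smul := by
    rintro ⟨n, ρ, t⟩
    exact congrArg (fun ρ' : (homSpace (twist L b) G).obj (op n) =>
      Quot.mk (RealizationRel (homSpace (twist L b) G)) ⟨n, ρ', t⟩)
      (translate_one (Γ := L.obj n) ρ)
  mul_smul g g' := by
    rintro ⟨n, ρ, t⟩
    exact congrArg (fun ρ' : (homSpace (twist L b) G).obj (op n) =>
      Quot.mk (RealizationRel (homSpace (twist L b) G)) ⟨n, ρ', t⟩)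
      (translate_mul (Γ := L.obj n) g g' ρ)

/-! ### Principal bundles and pullbacks of `k`-spaces -/

/-- `p : E → X` is a principal `G`-bundle (for a left action of `G` on `E`) in the category of
`k`-spaces: the action is continuous, and `X` is covered by open sets `U` over which there is a
homeomorphism `U × G ≅ p⁻¹(U)` over `U` that is equivariant for left translation on `G`. -/
structure IsPrincipalBundle (G : Type u) [Group G] [TopologicalSpace G] {E X : Type u}
    [TopologicalSpace E] [TopologicalSpace X] [MulAction G E] (p : E → X) : Prop where
  continuous : Continuous p
  continuous_smul : Continuous fun q : Kify (G × E) => q.val.1 • q.val.2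
  locally_trivial : ∀ x : X, ∃ U : Set X, IsOpen U ∧ x ∈ U ∧
    ∃ φ : Kify (U × G) ≃ₜ p ⁻¹' U,
      (∀ (y : U) (g : G), p (φ (Kify.mk (y, g))) = y) ∧
      ∀ (y : U) (g k : G), (φ (Kify.mk (y, g * k)) : E) = g • (φ (Kify.mk (y, k)) : E)

/-- The pullback `X ×_Y E` of `f : X → Y` and `p : E → Y` in the category of `k`-spaces. -/
abbrev KPullback {X Y E : Type u} [TopologicalSpace X] [TopologicalSpace E]
    (f : X → Y) (p : E → Y) : Type u :=
  Kify { q : X × E // f q.1 = p q.2 }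

/-- The principal `G`-bundle `p' : E' → X` is the pullback of `p : E → Y` along `f : X → Y`, by means
of the equivariant map `f' : E' → E` over `f`. -/
structure IsBundlePullback (G : Type u) [Group G] {E' X E Y : Type u}
    [TopologicalSpace E'] [TopologicalSpace X] [TopologicalSpace E]
    [MulAction G E'] [MulAction G E] (f' : E' → E) (p' : E' → X) (p : E → Y) (f : X → Y) :
    Prop where
  equivariant : ∀ (g : G) (e : E'), f' (g • e) = g • f' e
  comm : ∀ e : E', f (p' e) = p (f' e)
  isHomeomorph : IsHomeomorph fun e : E' => (Kify.mk ⟨(p' e, f' e), comm e⟩ : KPullback f p)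

end CosGrp

/-!
A point of `EG` is a `G`-valued step function: the point represented by `(x_0, …, x_n)` and
`(t_0, …, t_n) ∈ Δ^n` takes the value `x_i` on an interval of length `t_i`. Here `x_i` is the value
of a homomorphism `F^+_n → G` on `a_0 a_1 ⋯ a_i`; in these coordinates simplicial operators
reindex (`twistOp_vertexElt`) and `G` acts by left translation. Step functions are encoded as
weighted sequences, i.e. lists of pairs `(x_i, t_i)`, and `normalForm` selects one sequence for each
step function (`normalForm_map_fiber`).

The main point is that `EG` is covered by slices: open invariant subsets `V` with an equivariant
continuous map `r : V → G` (`exists_slice`). An NDR structure on `(G, {1})` gives a contraction of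
a neighbourhood of `1`, and hence an equivariant deformation of weighted sequences that decreases
all weights and contracts all quotients `x_{i-1}⁻¹ x_i`, until a weight or a quotient is used up
(`Contraction.degenerate_step`). Degenerate sequences, being normalizable to smaller
length, are left fixed. Starting with a step function with many steps, contraction and
normalization alternate; if a normal form with exactly `n + 1` steps is reached, `r` is its first
value. By induction on the length of the sequence, being able to reach such a normal form is an open
condition, and `r` is continuous (`Contraction.Reduces.eventually`): degenerate sequences
form a finite union of closed sets, on each of which the length can be reduced. Every point lies in
the domain for the length of its own normal form.

The rest is formal. `B(L, G)` is the orbit space of `B(L^b, G)`, by an open map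
(`B.isOrbitMap`), and continuity on products of `k`-spaces is tested on compact spaces. Slices
pull back along the equivariant map `B(L^b, G) → EG`. The function `e ↦ (r e)⁻¹ • e` on a slice
is constant on orbits, so it descends to a section `s`; then `(x, g) ↦ g • s x` is a local
trivialization, and `(x, e) ↦ r e • s x` is locally the inverse of the comparison map with
the pullback.
-/

namespace CosGrp

open CategoryTheory Topology Filter
open scoped NNReal

/-! ### Weighted sequences and their normal forms -/

section NormalForm

variable {G : Type*}

open Classical in
/-- Puts a weighted point in front of a weighted sequence: it is dropped if its weight vanishes, and
merged with the first point of the sequence if the two points agree. -/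
noncomputable def normCons (p : G × ℝ≥0) (l : List (G × ℝ≥0)) : List (G × ℝ≥0) :=
  if p.2 = 0 then l else
    match l with
    | [] => [p]
    | q :: l' => if p.1 = q.1 then (p.1, p.2 + q.2) :: l' else p :: q :: l'

/-- The normal form of a weighted sequence: points of weight `0` are dropped, and equal neighbours
are merged. Regarding `(x_i, t_i)` as the step function with value `x_i` on an interval
of length `t_i`, two sequences have the same normal form if and only if they are the same step
function. -/
noncomputable def normalForm (l : List (G × ℝ≥0)) : List (G × ℝ≥0) := l.foldr normCons []

@[simp] lemma normalForm_cons (p : G × ℝ≥0) (l : List (G × ℝ≥0)) :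
    normalForm (p :: l) = normCons p (normalForm l) := rfl

@[simp] lemma normCons_zero (x : G) (l : List (G × ℝ≥0)) : normCons (x, 0) l = l := by
  simp [normCons]

lemma normCons_merge (x : G) (s t : ℝ≥0) (l : List (G × ℝ≥0)) :
    normCons (x, s) (normCons (x, t) l) = normCons (x, s + t) l := by
  by_cases hs : s = 0
  · simp [hs]
  by_cases ht : t = 0
  · simp [ht]
  cases l with
  | nil => simp [normCons, hs, ht]
  | cons q l =>
    by_cases hq : x = q.1
    · simp [normCons, hs, ht, hq, add_assoc]
    · simp [normCons, hs, ht, hq]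

/-- A weighted sequence is degenerate if some weight vanishes or two neighbours agree. -/
inductive Degenerate : List (G × ℝ≥0) → Prop
  | zero (x : G) (l : List (G × ℝ≥0)) : Degenerate ((x, 0) :: l)
  | eq (x : G) (s t : ℝ≥0) (l : List (G × ℝ≥0)) : Degenerate ((x, s) :: (x, t) :: l)
  | tail (p : G × ℝ≥0) {l : List (G × ℝ≥0)} : Degenerate l → Degenerate (p :: l)

lemma degenerate_cons_iff (p : G × ℝ≥0) (l : List (G × ℝ≥0)) :
    Degenerate (p :: l) ↔ p.2 = 0 ∨ (∃ q l', l = q :: l' ∧ p.1 = q.1) ∨ Degenerate l := by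
  obtain ⟨x, s⟩ := p
  constructor
  · intro h
    cases h with
    | zero => exact .inl rfl
    | eq _ _ t l => exact .inr (.inl ⟨_, _, rfl, rfl⟩)
    | tail _ h => exact .inr (.inr h)
  · rintro (rfl | ⟨⟨y, t⟩, l', rfl, rfl⟩ | h)
    · exact .zero _ _
    · exact .eq _ _ _ _
    · exact h.tail _

lemma normalForm_eq_self {l : List (G × ℝ≥0)} (h : ¬ Degenerate l) : normalForm l = l := by
  induction l with
  | nil => rfl
  | cons p l ih =>
    rw [degenerate_cons_iff, not_or, not_or] at h
    rw [normalForm_cons, ih h.2.2]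
    cases l with
    | nil => simp [normCons, h.1]
    | cons q l =>
      have hq : p.1 ≠ q.1 := fun hq => h.2.1 ⟨q, l, rfl, hq⟩
      simp [normCons, h.1, hq]

lemma not_degenerate_normCons {l : List (G × ℝ≥0)} (h : ¬ Degenerate l) (p : G × ℝ≥0) :
    ¬ Degenerate (normCons p l) := by
  by_cases h0 : p.2 = 0
  · simpa [normCons, h0] using h
  cases l with
  | nil => simp [normCons, h0, degenerate_cons_iff, h]
  | cons q l =>
    by_cases hq : p.1 = q.1
    · simp_all [normCons, degenerate_cons_iff]
    · simp only [normCons, h0, hq, if_false]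
      rw [degenerate_cons_iff]
      simp [h0, hq, h]

lemma not_degenerate_normalForm (l : List (G × ℝ≥0)) : ¬ Degenerate (normalForm l) := by
  induction l with
  | nil => rintro ⟨⟩
  | cons p l ih => exact not_degenerate_normCons ih p

lemma normalForm_normalForm (l : List (G × ℝ≥0)) : normalForm (normalForm l) = normalForm l :=
  normalForm_eq_self (not_degenerate_normalForm l)

lemma length_normCons_le (p : G × ℝ≥0) (l : List (G × ℝ≥0)) :
    (normCons p l).length ≤ l.length + 1 := by
  unfold normCons
  split_ifs
  · simp
  · cases l with
    | nil => simp
    | cons q l => dsimp only; split_ifs <;> simp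

lemma length_normalForm_le (l : List (G × ℝ≥0)) : (normalForm l).length ≤ l.length := by
  induction l with
  | nil => exact le_rfl
  | cons p l ih => exact (length_normCons_le _ _).trans (Nat.succ_le_succ ih)

lemma length_normalForm_lt {l : List (G × ℝ≥0)} (h : Degenerate l) :
    (normalForm l).length < l.length := by
  induction h with
  | zero x l => simpa using Nat.lt_succ_of_le (length_normalForm_le l)
  | eq x s t l =>
    rw [normalForm_cons, normalForm_cons, normCons_merge]
    exact ((length_normCons_le _ _).trans
      (Nat.succ_le_succ (length_normalForm_le l))).trans_lt (by simp)
  | tail p _ ih => exact (length_normCons_le _ _).trans_lt (Nat.succ_lt_succ ih)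

/-- Left translation of the points of a weighted sequence. -/
def translateSeq [Mul G] (g : G) (l : List (G × ℝ≥0)) : List (G × ℝ≥0) :=
  l.map fun p => (g * p.1, p.2)

lemma translateSeq_normalForm [Group G] (g : G) (l : List (G × ℝ≥0)) :
    normalForm (translateSeq g l) = translateSeq g (normalForm l) := by
  induction l with
  | nil => rfl
  | cons p l ih =>
    change normCons _ (normalForm (translateSeq g l)) = _
    rw [ih, normalForm_cons]
    by_cases h0 : p.2 = 0
    · simp [normCons, h0]
    cases normalForm l with
    | nil => simp [normCons, h0, translateSeq]
    | cons q l' =>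
      by_cases hq : p.1 = q.1
      · simp [normCons, h0, translateSeq, hq]
      · simp [normCons, h0, translateSeq, hq]

end NormalForm

/-! ### Contracting weighted sequences towards degenerate ones -/

/-- A function `v` and a homotopy `H` on a group that contract a neighbourhood of `1` in such a way
that `y` with `v y < 1` has reached `1` at time `v y`. -/
structure Contraction (G : Type*) [Group G] [TopologicalSpace G] where
  /-- the time at which a point near `1` reaches `1` -/
  v : G → ℝ≥0
  /-- the contracting homotopy -/
  H : G × ℝ≥0 → G
  continuous_v : Continuous v
  continuous_H : Continuous H
  v_one : v 1 = 0
  H_zero : ∀ y, H (y, 0) = y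
  H_v : ∀ y, v y < 1 → H (y, v y) = 1

namespace Contraction

variable {G : Type*} [Group G] [TopologicalSpace G] (C : Contraction G)

/-- The size of the jump from `x` to the first point of a sequence (`1` for the empty sequence). -/
def jump (x : G) : List (G × ℝ≥0) → ℝ≥0
  | [] => 1
  | q :: _ => C.v (x⁻¹ * q.1)

/-- The minimum of `1`, of all weights and of all sizes of jumps between neighbours. It
vanishes on degenerate sequences. -/
def gap : List (G × ℝ≥0) → ℝ≥0
  | [] => 1
  | p :: l => min p.2 (min (C.jump p.1 l) (gap l))

/-- The part of `Contraction.step` following a point `x` that has been moved to `x'`. -/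
def stepAux (w : ℝ≥0) : G → G → List (G × ℝ≥0) → List (G × ℝ≥0)
  | _, _, [] => []
  | x, x', q :: l => (x' * C.H (x⁻¹ * q.1, w), q.2 - w) ::
      stepAux w q.1 (x' * C.H (x⁻¹ * q.1, w)) l

/-- Decreases all weights by `w`, and contracts the quotients of neighbours for the time `w`,
keeping the first point. -/
def step (w : ℝ≥0) : List (G × ℝ≥0) → List (G × ℝ≥0)
  | [] => []
  | p :: l => (p.1, p.2 - w) :: C.stepAux w p.1 p.1 l

lemma stepAux_zero (x : G) (l : List (G × ℝ≥0)) : C.stepAux 0 x x l = l := by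
  induction l generalizing x with
  | nil => rfl
  | cons q l ih => simp [stepAux, C.H_zero, ih]

lemma step_zero (l : List (G × ℝ≥0)) : C.step 0 l = l := by
  cases l with
  | nil => rfl
  | cons p l => simp [step, stepAux_zero]

lemma gap_eq_zero {l : List (G × ℝ≥0)} (h : Degenerate l) : C.gap l = 0 := by
  induction h with
  | zero x l => simp [gap]
  | eq x s t l => simp [gap, jump, C.v_one]
  | tail p _ ih => simp [gap, ih]

lemma degenerate_stepAux {w : ℝ≥0} (hw : w < 1) (l : List (G × ℝ≥0)) (x x' : G) (s : ℝ≥0)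
    (h : min (C.jump x l) (C.gap l) = w) : Degenerate ((x', s) :: C.stepAux w x x' l) := by
  induction l generalizing x x' s with
  | nil => simp only [jump, gap, min_self] at h; exact absurd h hw.ne'
  | cons q l ih =>
    change min (C.v (x⁻¹ * q.1)) (min q.2 (min (C.jump q.1 l) (C.gap l))) = w at h
    simp only [stepAux]
    rcases min_choice (C.v (x⁻¹ * q.1)) (min q.2 (min (C.jump q.1 l) (C.gap l))) with h1 | h1
    · rw [h1] at h
      subst h
      rw [C.H_v _ hw, mul_one]
      exact .eq _ _ _ _
    rw [h1] at h
    rcases min_choice q.2 (min (C.jump q.1 l) (C.gap l)) with h2 | h2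
    · rw [h2] at h
      subst h
      rw [tsub_self]
      exact (Degenerate.zero _ _).tail _
    · rw [h2] at h
      exact (ih _ _ _ h).tail _

/-- At time `gap l` some weight or some jump has been used up. -/
lemma degenerate_step {l : List (G × ℝ≥0)} (h : C.gap l < 1) :
    Degenerate (C.step (C.gap l) l) := by
  cases l with
  | nil => simp [gap] at h
  | cons p l =>
    simp only [step]
    rcases min_choice p.2 (min (C.jump p.1 l) (C.gap l)) with h2 | h2
    · have : C.gap (p :: l) = p.2 := h2
      rw [this, tsub_self]
      exact .zero _ _
    · exact C.degenerate_stepAux h l _ _ _ h2.symm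

lemma gap_translateSeq (g : G) (l : List (G × ℝ≥0)) : C.gap (translateSeq g l) = C.gap l := by
  induction l with
  | nil => rfl
  | cons p l ih =>
    change min p.2 (min (C.jump _ (translateSeq g l)) (C.gap (translateSeq g l))) = _
    rw [ih, gap]
    congr 2
    cases l <;> simp [jump, translateSeq, mul_assoc]

lemma step_translateSeq (g : G) (w : ℝ≥0) (l : List (G × ℝ≥0)) :
    C.step w (translateSeq g l) = translateSeq g (C.step w l) := by
  have aux : ∀ (l : List (G × ℝ≥0)) (x x' : G), C.stepAux w (g * x) (g * x') (translateSeq g l) =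
      translateSeq g (C.stepAux w x x' l) := by
    intro l
    induction l with
    | nil => intros; rfl
    | cons q l ih =>
      intro x x'
      change (g * x' * C.H ((g * x)⁻¹ * (g * q.1), w), q.2 - w) ::
        C.stepAux w (g * q.1) (g * x' * C.H ((g * x)⁻¹ * (g * q.1), w)) (translateSeq g l) = _
      have : (g * x)⁻¹ * (g * q.1) = x⁻¹ * q.1 := by group
      rw [this, mul_assoc, ih]
      rfl
  cases l with
  | nil => rfl
  | cons p l =>
    change (g * p.1, p.2 - w) :: C.stepAux w (g * p.1) (g * p.1) (translateSeq g l) = _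
    rw [aux]
    rfl

/-- `C.Reduces n l g` says that alternately normalizing and contracting the sequence `l` leads to a
normal form of length `n + 1`, with first point `g`. -/
inductive Reduces (n : ℕ) : List (G × ℝ≥0) → G → Prop
  | base {l l' : List (G × ℝ≥0)} {p : G × ℝ≥0} (h : normalForm l = p :: l')
      (hl : l'.length = n) : Reduces n l p.1
  | step {l : List (G × ℝ≥0)} {g : G} (hl : n + 1 < (normalForm l).length)
      (hw : C.gap (normalForm l) < 1)
      (h : Reduces n (C.step (C.gap (normalForm l)) (normalForm l)) g) : Reduces n l g

variable {C}

lemma Reduces.unique {n : ℕ} {l : List (G × ℝ≥0)} {g g' : G} (h : C.Reduces n l g)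
    (h' : C.Reduces n l g') : g = g' := by
  induction h with
  | base h hl =>
    cases h' with
    | base h₂ hl₂ => rw [h] at h₂; injection h₂ with h₂; rw [h₂]
    | step hl₂ => rw [h] at hl₂; simp [hl] at hl₂
  | step hl hw _ ih =>
    cases h' with
    | base h₂ hl₂ => rw [h₂] at hl; simp [hl₂] at hl
    | step _ _ h₂ => exact ih h₂

lemma Reduces.congr {n : ℕ} {l l' : List (G × ℝ≥0)} {g : G} (h : C.Reduces n l g)
    (e : normalForm l = normalForm l') : C.Reduces n l' g := by
  cases h with
  | base h hl => exact .base (e ▸ h) hl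
  | step hl hw h => rw [e] at hl hw h; exact .step hl hw h

lemma Reduces.translate {n : ℕ} {l : List (G × ℝ≥0)} {g : G} (h : C.Reduces n l g) (k : G) :
    C.Reduces n (translateSeq k l) (k * g) := by
  induction h with
  | @base l l' p h hl =>
    refine .base (p := (k * p.1, p.2)) (l' := translateSeq k l') ?_ (by simpa [translateSeq])
    rw [translateSeq_normalForm, h]
    rfl
  | step hl hw _ ih =>
    refine .step ?_ ?_ ?_
    · rw [translateSeq_normalForm]; simpa [translateSeq] using hl
    · rwa [translateSeq_normalForm, gap_translateSeq]
    · rwa [translateSeq_normalForm, gap_translateSeq, step_translateSeq]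

lemma Reduces.lt_length {n : ℕ} {l : List (G × ℝ≥0)} {g : G} (h : C.Reduces n l g) :
    n < (normalForm l).length := by
  cases h with
  | base h hl => simp [h, hl]
  | step hl => omega

end Contraction

/-! ### Continuous families of weighted sequences -/

section Family

variable {G Z : Type*} [TopologicalSpace G] [TopologicalSpace Z]

/-- The value at `z` of a continuous family of weighted sequences of constant length. -/
def evalSeq (φ : List (C(Z, G) × C(Z, ℝ≥0))) (z : Z) : List (G × ℝ≥0) :=
  φ.map fun p => (p.1 z, p.2 z)

@[simp] lemma evalSeq_cons (p : C(Z, G) × C(Z, ℝ≥0)) (φ : List (C(Z, G) × C(Z, ℝ≥0))) (z : Z) :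
    evalSeq (p :: φ) z = (p.1 z, p.2 z) :: evalSeq φ z := rfl

@[simp] lemma length_evalSeq (φ : List (C(Z, G) × C(Z, ℝ≥0))) (z : Z) :
    (evalSeq φ z).length = φ.length := by simp [evalSeq]

/-- The parameters at which a family is degenerate form a finite union of closed sets; on each of
them the family has the same normal forms as a family of smaller length, which is defined for all
parameters. -/
lemma exists_reductions [T2Space G] (φ : List (C(Z, G) × C(Z, ℝ≥0))) :
    ∃ S : List (Set Z × List (C(Z, G) × C(Z, ℝ≥0))),
      (∀ c ∈ S, IsClosed c.1 ∧ c.2.length < φ.length ∧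
        ∀ z ∈ c.1, normalForm (evalSeq φ z) = normalForm (evalSeq c.2 z)) ∧
      ∀ z, Degenerate (evalSeq φ z) ↔ ∃ c ∈ S, z ∈ c.1 := by
  induction φ with
  | nil => exact ⟨[], by simp, fun z => ⟨by rintro ⟨⟩, by simp⟩⟩
  | cons p φ ih =>
    obtain ⟨S, hS, hS'⟩ := ih
    let S₁ : List (Set Z × List (C(Z, G) × C(Z, ℝ≥0))) := S.map fun c => (c.1, p :: c.2)
    let c₀ : Set Z × List (C(Z, G) × C(Z, ℝ≥0)) := ({z | p.2 z = 0}, φ)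
    have h₁ : ∀ c ∈ S₁, IsClosed c.1 ∧ c.2.length < (p :: φ).length ∧
        ∀ z ∈ c.1, normalForm (evalSeq (p :: φ) z) = normalForm (evalSeq c.2 z) := by
      intro c hc
      obtain ⟨c, hcS, rfl⟩ := List.mem_map.1 hc
      refine ⟨(hS c hcS).1, by simpa using (hS c hcS).2.1, fun z hz => ?_⟩
      simp [(hS c hcS).2.2 z hz]
    have h₀ : IsClosed c₀.1 ∧ c₀.2.length < (p :: φ).length ∧
        ∀ z ∈ c₀.1, normalForm (evalSeq (p :: φ) z) = normalForm (evalSeq c₀.2 z) := by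
      refine ⟨isClosed_eq p.2.continuous continuous_const, by simp [c₀], fun z hz => ?_⟩
      have : p.2 z = 0 := hz
      simp [this, c₀]
    have hS₁ : ∀ z, (∃ c ∈ S₁, z ∈ c.1) ↔ Degenerate (evalSeq φ z) := fun z => by
      simp [S₁, hS']
    cases φ with
    | nil =>
      refine ⟨c₀ :: S₁, fun c hc => ?_, fun z => ?_⟩
      · rcases List.mem_cons.1 hc with rfl | hc
        exacts [h₀, h₁ c hc]
      · rw [evalSeq_cons, degenerate_cons_iff, List.exists_mem_cons_iff, hS₁]
        simp [c₀, evalSeq]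
    | cons q φ =>
      let c₁ : Set Z × List (C(Z, G) × C(Z, ℝ≥0)) :=
        ({z | p.1 z = q.1 z}, (p.1, p.2 + q.2) :: φ)
      have h₂ : IsClosed c₁.1 ∧ c₁.2.length < (p :: q :: φ).length ∧
          ∀ z ∈ c₁.1, normalForm (evalSeq (p :: q :: φ) z) = normalForm (evalSeq c₁.2 z) := by
        refine ⟨isClosed_eq p.1.continuous q.1.continuous, by simp [c₁], fun z hz => ?_⟩
        have hz' : q.1 z = p.1 z := Eq.symm hz
        simp [c₁, hz', normCons_merge]
      refine ⟨c₀ :: c₁ :: S₁, fun c hc => ?_, fun z => ?_⟩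
      · rcases List.mem_cons.1 hc with rfl | hc
        · exact h₀
        rcases List.mem_cons.1 hc with rfl | hc
        exacts [h₂, h₁ c hc]
      · rw [evalSeq_cons, degenerate_cons_iff, List.exists_mem_cons_iff, List.exists_mem_cons_iff,
          hS₁]
        simp [c₀, c₁]

lemma isClosed_degenerate [T2Space G] (φ : List (C(Z, G) × C(Z, ℝ≥0))) :
    IsClosed {z | Degenerate (evalSeq φ z)} := by
  obtain ⟨S, hS, hS'⟩ := exists_reductions φ
  have : {z | Degenerate (evalSeq φ z)} = ⋃ c ∈ {c | c ∈ S}, c.1 := by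
    ext z; simp [hS']
  rw [this]
  exact S.finite_toSet.isClosed_biUnion fun c hc => (hS c hc).1

end Family

namespace Contraction

variable {G Z : Type*} [Group G] [TopologicalSpace G] [TopologicalSpace Z] (C : Contraction G)

/-- `Z` sees `G` as a topological group: pointwise quotients and products of continuous
maps `Z → G` are continuous. -/
def OperationsContinuous (G Z : Type*) [Group G] [TopologicalSpace G] [TopologicalSpace Z] :
    Prop :=
  ∀ x y : Z → G, Continuous x → Continuous y →
    Continuous (fun z => x z * y z) ∧ Continuous fun z => (x z)⁻¹ * y z

lemma continuous_gap (hZ : OperationsContinuous G Z) (φ : List (C(Z, G) × C(Z, ℝ≥0))) :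
    Continuous fun z => C.gap (evalSeq φ z) := by
  induction φ with
  | nil => exact continuous_const
  | cons p φ ih =>
    refine p.2.continuous.min (Continuous.min ?_ ih)
    cases φ with
    | nil => exact continuous_const
    | cons q φ => exact C.continuous_v.comp (hZ _ _ p.1.continuous q.1.continuous).2

lemma exists_step_family (hZ : OperationsContinuous G Z) (w : C(Z, ℝ≥0))
    (φ : List (C(Z, G) × C(Z, ℝ≥0))) :
    ∃ ψ : List (C(Z, G) × C(Z, ℝ≥0)), ψ.length = φ.length ∧
      ∀ z, evalSeq ψ z = C.step (w z) (evalSeq φ z) := by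
  have aux : ∀ (φ : List (C(Z, G) × C(Z, ℝ≥0))) (x x' : C(Z, G)),
      ∃ ψ : List (C(Z, G) × C(Z, ℝ≥0)), ψ.length = φ.length ∧
        ∀ z, evalSeq ψ z = C.stepAux (w z) (x z) (x' z) (evalSeq φ z) := by
    intro φ
    induction φ with
    | nil => exact fun x x' => ⟨[], rfl, fun z => rfl⟩
    | cons q φ ih =>
      intro x x'
      have hy : Continuous fun z => x' z * C.H ((x z)⁻¹ * q.1 z, w z) :=
        (hZ _ _ x'.continuous (C.continuous_H.comp
          ((hZ _ _ x.continuous q.1.continuous).2.prodMk w.continuous))).1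
      obtain ⟨ψ, hψ, hψ'⟩ := ih q.1 ⟨_, hy⟩
      refine ⟨(⟨_, hy⟩, q.2 - w) :: ψ, by simp [hψ], fun z => ?_⟩
      rw [evalSeq_cons, hψ']
      rfl
  cases φ with
  | nil => exact ⟨[], rfl, fun z => rfl⟩
  | cons p φ =>
    obtain ⟨ψ, hψ, hψ'⟩ := aux φ p.1 p.1
    refine ⟨(p.1, p.2 - w) :: ψ, by simp [hψ], fun z => ?_⟩
    rw [evalSeq_cons, hψ']
    rfl

variable {C}

/-- In a continuous family of weighted sequences, `Contraction.Reduces` is an open condition, and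
the point to which the sequences reduce is a continuous function of the parameter. -/
lemma Reduces.eventually [T2Space G] (hZ : OperationsContinuous G Z) {n : ℕ}
    (φ : List (C(Z, G) × C(Z, ℝ≥0))) {z₀ : Z} {g : G} (h : C.Reduces n (evalSeq φ z₀) g)
    {O : Set G} (hO : O ∈ 𝓝 g) : ∀ᶠ z in 𝓝 z₀, ∃ g' ∈ O, C.Reduces n (evalSeq φ z) g' := by
  induction hm : φ.length using Nat.strong_induction_on generalizing φ g with
  | _ m ih =>
  subst hm
  have hn : n < φ.length := h.lt_length.trans_le
    ((length_normalForm_le _).trans_eq (length_evalSeq φ z₀))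
  rcases Nat.lt_or_ge (n + 1) φ.length with hn' | hn'
  · -- `ψ` is the family of contracted sequences, which are degenerate near `z₀`
    obtain ⟨ψ, hψ, hψ'⟩ := C.exists_step_family hZ ⟨_, C.continuous_gap hZ φ⟩ φ
    simp only [ContinuousMap.coe_mk] at hψ'
    -- degenerate sequences are not moved, so `ψ` may replace `φ`
    have hdeg : ∀ z, Degenerate (evalSeq φ z) → evalSeq ψ z = evalSeq φ z := fun z hz => by
      rw [hψ', C.gap_eq_zero hz, C.step_zero]
    have key : C.gap (evalSeq φ z₀) < 1 ∧ C.Reduces n (evalSeq ψ z₀) g := by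
      by_cases hz : Degenerate (evalSeq φ z₀)
      · exact ⟨by simp [C.gap_eq_zero hz], (hdeg z₀ hz).symm ▸ h⟩
      · have hnf := normalForm_eq_self hz
        cases h with
        | base h hl =>
          have := congrArg List.length (hnf.symm.trans h)
          simp [hl] at this
          omega
        | step hl hw h =>
          rw [hnf] at hw h
          exact ⟨hw, hψ' z₀ ▸ h⟩
    have back : ∀ z, C.gap (evalSeq φ z) < 1 → ∀ g', C.Reduces n (evalSeq ψ z) g' →
        C.Reduces n (evalSeq φ z) g' := by
      intro z hz g' hg'
      by_cases hd : Degenerate (evalSeq φ z)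
      · exact hdeg z hd ▸ hg'
      · have hnf := normalForm_eq_self hd
        refine .step ?_ ?_ ?_
        · simpa [hnf] using hn'
        · rwa [hnf]
        · rw [hnf, ← hψ']; exact hg'
    have hgap : ∀ᶠ z in 𝓝 z₀, C.gap (evalSeq φ z) < 1 :=
      (C.continuous_gap hZ φ).continuousAt.eventually_lt continuousAt_const key.1
    obtain ⟨S, hS, hS'⟩ := exists_reductions ψ
    have hloc : ∀ c ∈ S, ∀ᶠ z in 𝓝 z₀, z ∈ c.1 → ∃ g' ∈ O, C.Reduces n (evalSeq ψ z) g' := by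
      intro c hc
      obtain ⟨hcl, hlen, hnf⟩ := hS c hc
      by_cases hz : z₀ ∈ c.1
      · filter_upwards [ih c.2.length (hψ ▸ hlen) c.2 (key.2.congr (hnf z₀ hz)) hO rfl]
          with z hz' hzc
        obtain ⟨g', hg', hr⟩ := hz'
        exact ⟨g', hg', hr.congr (hnf z hzc).symm⟩
      · filter_upwards [hcl.isOpen_compl.mem_nhds hz] with z hz' hzc
        exact absurd hzc hz'
    have hall : ∀ᶠ z in 𝓝 z₀, ∀ c ∈ S, z ∈ c.1 → ∃ g' ∈ O, C.Reduces n (evalSeq ψ z) g' :=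
      (Filter.eventually_all_finite (S.finite_toSet)).2 hloc
    filter_upwards [hgap, hall] with z hz hz'
    have hd : Degenerate (evalSeq ψ z) := hψ' z ▸ C.degenerate_step hz
    obtain ⟨c, hc, hzc⟩ := (hS' z).1 hd
    obtain ⟨g', hg', hr⟩ := hz' c hc hzc
    exact ⟨g', hg', back z hz g' hr⟩
  · -- sequences of length `n + 1` reduce if and only if they are in normal form
    have hnd : ¬ Degenerate (evalSeq φ z₀) := fun hd => by
      have h₁ := length_normalForm_lt hd
      have h₂ := h.lt_length
      rw [length_evalSeq] at h₁
      omega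
    cases φ with
    | nil => simp at hn
    | cons p φ =>
      have hnormal : ∀ z, ¬ Degenerate (evalSeq (p :: φ) z) →
          C.Reduces n (evalSeq (p :: φ) z) (p.1 z) := fun z hz =>
        .base (p := (p.1 z, p.2 z)) (l' := evalSeq φ z) (normalForm_eq_self hz) (by
          simp only [List.length_cons] at hn hn'
          simp only [length_evalSeq]
          omega)
      rw [h.unique (hnormal z₀ hnd)] at hO
      filter_upwards [(isClosed_degenerate (p :: φ)).isOpen_compl.mem_nhds hnd,
        p.1.continuous.continuousAt hO] with z hz hz'
      exact ⟨_, hz', hnormal z hz⟩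

end Contraction

/-! ### Normal forms and monotone reindexing -/

section Reindex

variable {G ι κ : Type*} [LinearOrder κ]

lemma normalForm_eq_nil {l : List (G × ℝ≥0)} (h : ∀ p ∈ l, p.2 = 0) : normalForm l = [] := by
  induction l with
  | nil => rfl
  | cons p l ih =>
    rw [normalForm_cons, ih fun q hq => h q (by simp [hq])]
    simp [normCons, h p (by simp)]

lemma eq_zero_of_normalForm_eq_nil {l : List (G × ℝ≥0)} (h : normalForm l = []) :
    ∀ p ∈ l, p.2 = 0 := by
  induction l with
  | nil => simp
  | cons p l ih =>
    rw [normalForm_cons] at h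
    by_cases hp : p.2 = 0
    · simp only [normCons, hp, if_true] at h
      simpa [hp] using ih h
    · cases hl : normalForm l with
      | nil => simp [normCons, hp, hl] at h
      | cons q l' => simp only [normCons, hp, hl, if_false] at h; split_ifs at h

/-- Adding weight at an index before which all weights vanish. -/
lemma normalForm_map_add_single (x : κ → G) (c : κ → ℝ≥0) (j₀ : κ) (t : ℝ≥0) (J : List κ)
    (hJ : J.Pairwise (· < ·)) (hj₀ : j₀ ∈ J) (hc : ∀ j < j₀, c j = 0) :
    normalForm (J.map fun j => (x j, (if j₀ = j then t else 0) + c j)) =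
      normCons (x j₀, t) (normalForm (J.map fun j => (x j, c j))) := by
  induction J with
  | nil => simp at hj₀
  | cons a J ih =>
    rw [List.pairwise_cons] at hJ
    by_cases ha : j₀ = a
    · subst ha
      have : J.map (fun j => (x j, (if j₀ = j then t else 0) + c j)) =
          J.map fun j => (x j, c j) :=
        List.map_congr_left fun j hj => by simp [(hJ.1 j hj).ne]
      simp [this, normCons_merge]
    · have hj : j₀ ∈ J := by simpa [ha] using hj₀
      have := ih hJ.2 hj
      simp [this, ha, hc a (hJ.1 j₀ hj)]

/-- Replacing the weights of a sequence by their sums over the fibres of a monotone map of the index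
sets does not change the normal form, if the points are constant on the fibres. -/
lemma normalForm_map_fiber (θ : ι → κ) (x : κ → G) (t : ι → ℝ≥0) (J : List κ)
    (hJ : J.Pairwise (· < ·)) (I : List ι) (hI : I.Pairwise fun i i' => θ i ≤ θ i')
    (hIJ : ∀ i ∈ I, θ i ∈ J) :
    normalForm (I.map fun i => (x (θ i), t i)) =
      normalForm (J.map fun j => (x j, (I.map fun i => if θ i = j then t i else 0).sum)) := by
  induction I with
  | nil =>
    rw [normalForm_eq_nil (l := J.map _) (by simp)]
    rfl
  | cons i I ih =>
    rw [List.pairwise_cons] at hI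
    simp only [List.map_cons, List.sum_cons, normalForm_cons]
    rw [ih hI.2 fun i hi => hIJ i (by simp [hi])]
    refine (normalForm_map_add_single x _ (θ i) (t i) J hJ (hIJ i (by simp)) fun j hj => ?_).symm
    refine List.sum_eq_zero fun s hs => ?_
    obtain ⟨i', hi', rfl⟩ := List.mem_map.1 hs
    exact if_neg (hj.trans_le (hI.1 i' hi')).ne'

end Reindex

/-! ### Generalities on `k`-spaces -/

/-- `Y` is a `k`-space. -/
abbrev IsKSpace (Y : Type u) [TopologicalSpace Y] : Prop :=
  IsGeneratedBy (fun K : CompHaus.{u} => (K : Type u)) Y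

section KSpace

variable {Y Z : Type u} [TopologicalSpace Y] [TopologicalSpace Z]

lemma isKSpace_of_compactlyGeneratedSpace [CompactlyGeneratedSpace Y] : IsKSpace Y where
  continuous_equiv_symm := continuous_from_uCompactlyGeneratedSpace _ fun _ f =>
    (IsGeneratedBy.equiv_symm_comp_continuous_iff (fun K : CompHaus.{u} => (K : Type u)) f).2
      f.continuous

lemma isKSpace_of_isOpen_of_compactSpace [T2Space Y] [CompactSpace Y] {U : Set Y}
    (hU : IsOpen U) : IsKSpace U :=
  have : LocallyCompactSpace U := hU.locallyCompactSpace
  have : CompactlyGeneratedSpace U := inferInstance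
  isKSpace_of_compactlyGeneratedSpace

lemma isKSpace_of_isOpen [IsKSpace Y] {U : Set Y} (hU : IsOpen U) : IsKSpace U := by
  have : ∀ (K : CompHaus.{u}) (V : TopologicalSpace.Opens K), IsKSpace V := fun K V =>
    isKSpace_of_isOpen_of_compactSpace V.isOpen
  exact hU.isGeneratedBy

lemma continuous_kify_mk [IsKSpace Z] {f : Z → Y} (hf : Continuous f) :
    Continuous fun z => Kify.mk (f z) :=
  (IsGeneratedBy.equiv_symm_comp_continuous_iff (fun K : CompHaus.{u} => (K : Type u)) f).2 hf

lemma continuous_kify_val : Continuous (Kify.val : Kify Y → Y) :=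
  WithGeneratedByTopology.continuous_equiv

lemma continuous_kify_iff (f : Kify Y → Z) :
    Continuous f ↔ ∀ (K : CompHaus.{u}) (a : C(K, Y)), Continuous fun k => f (Kify.mk (a k)) :=
  WithGeneratedByTopology.continuous_from_iff f

/-- Continuity of a map on the product of a `k`-space and a locally compact space may be tested on
compact Hausdorff spaces mapping to the first factor: adjoin the second factor to the target
by currying. -/
lemma continuous_prod_of_isKSpace [IsKSpace Y] {T W : Type*} [TopologicalSpace T]
    [LocallyCompactSpace T] [TopologicalSpace W] (f : Y × T → W)
    (hf : ∀ (K : CompHaus.{u}) (a : C(K, Y)), Continuous fun p : K × T => f (a p.1, p.2)) :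
    Continuous f := by
  have hy : ∀ y, Continuous fun t => f (y, t) := fun y => by
    have := hf (CompHaus.of PUnit.{u + 1}) ⟨fun _ => y, continuous_const⟩
    exact this.comp (continuous_const (y := PUnit.unit) |>.prodMk continuous_id)
  have hc : Continuous fun y => (⟨fun t => f (y, t), hy y⟩ : C(T, W)) := by
    rw [IsGeneratedBy.continuous_iff (fun K : CompHaus.{u} => (K : Type u))]
    intro K a
    exact (ContinuousMap.curry ⟨_, hf K a⟩).continuous
  exact ContinuousMap.continuous_uncurry_of_continuous ⟨_, hc⟩

lemma isKSpace_prod [IsKSpace Y] {T : Type} [TopologicalSpace T] [CompactSpace T] [T2Space T] :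
    IsKSpace (Y × T) where
  continuous_equiv_symm := continuous_prod_of_isKSpace _ fun K a => by
    have : IsKSpace (K × T) :=
      inferInstanceAs (IsKSpace (CompHaus.of (K × T)))
    exact continuous_kify_mk (a.continuous.prodMap continuous_id)

end KSpace

/-! ### `k`-groups -/

section KGroup

variable {G Z : Type u} [Group G] [TopologicalSpace G] [IsKGroup G] [TopologicalSpace Z]

lemma operationsContinuous_of_isKSpace [IsKSpace Z] :
    Contraction.OperationsContinuous G Z := by
  have key : ∀ x y : Z → G, Continuous x → Continuous y → Continuous fun z => x z * y z :=
    fun x y hx hy => IsKGroup.continuous_mul.comp (continuous_kify_mk (hx.prodMk hy))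
  exact fun x y hx hy => ⟨key x y hx hy, key _ _ (IsKGroup.continuous_inv.comp hx) hy⟩

/-- A well based group is Hausdorff: a function vanishing only at `1` can be translated so
as to separate any two points. -/
lemma t2Space_of_wellBased [CompactlyGeneratedSpace G] (hG : WellBased G) : T2Space G := by
  have : IsKSpace G := isKSpace_of_compactlyGeneratedSpace
  obtain ⟨h, v, hv, -⟩ := hG
  have hv' : ∀ y, v y = 0 ↔ y = 1 := fun y => by
    rw [← Set.mem_singleton_iff (b := (1 : G)), hv]; rfl
  refine ⟨fun x y hxy => ?_⟩
  have hc : Continuous fun z => v (x⁻¹ * z) := v.continuous.comp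
    (operationsContinuous_of_isKSpace _ _ continuous_const continuous_id).2
  refine separated_by_continuous hc fun h => hxy ?_
  have h1 : v (x⁻¹ * x) = 0 := (hv' _).2 (by simp)
  have h2 : v (x⁻¹ * y) = 0 := h ▸ h1
  simpa [inv_mul_eq_one] using (hv' _).1 h2

omit [IsKGroup G] in
/-- The contraction runs through the homotopy of the NDR pair `(G, 1)` while the time `w` runs from
`v y / 2` to `v y`. -/
lemma exists_contraction (hG : WellBased G) : Nonempty (Contraction G) := by
  obtain ⟨h, v, hv, h0, h1, hv1⟩ := hG
  have hv' : ∀ y, v y = 0 ↔ y = 1 := fun y => by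
    rw [← Set.mem_singleton_iff (b := (1 : G)), hv]; rfl
  let s : G × ℝ≥0 → unitInterval := fun p =>
    Set.projIcc 0 1 zero_le_one ((2 * (p.2 : ℝ) - v p.1) / p.2)
  have hs : ∀ p : G × ℝ≥0, 2 * (p.2 : ℝ) - v p.1 ≤ 0 → s p = 0 := fun p hp =>
    Set.projIcc_of_le_left _ (div_nonpos_of_nonpos_of_nonneg hp p.2.2)
  have hH0 : ∀ y, h (y, s (y, 0)) = y := fun y => by
    rw [hs _ (by simpa using (v y).2.1), h0]
  refine ⟨⟨fun y => ⟨v y, (v y).2.1⟩, fun p => h (p.1, s p), ?_, ?_, ?_, hH0, ?_⟩⟩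
  · exact (continuous_subtype_val.comp v.continuous).subtype_mk _
  · rw [continuous_iff_continuousAt]
    rintro ⟨y₀, w₀⟩
    by_cases hw : w₀ = 0
    · subst hw
      by_cases hy : y₀ = 1
      · -- near `(1, 0)` the time `s` is not continuous, but `h` is close to `1` for all times
        subst hy
        intro O hO
        have hO' : O ∈ 𝓝 (1 : G) := by simpa only [hH0] using hO
        have : ∀ᶠ y in 𝓝 (1 : G), ∀ t ∈ (Set.univ : Set unitInterval), h (y, t) ∈ O :=
          isCompact_univ.eventually_forall_of_forall_eventually fun t _ =>
            h.continuous.continuousAt (x := (1, t)) (by rw [h1 1 rfl]; exact hO')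
        rw [nhds_prod_eq]
        exact (this.prod_inl (𝓝 (0 : ℝ≥0))).mono fun p hp => hp _ trivial
      · have hpos : 0 < (v y₀ : ℝ) :=
          lt_of_le_of_ne (v y₀).2.1 fun h => hy ((hv' y₀).1 (Subtype.ext h.symm))
        have hlt : ∀ᶠ p : G × ℝ≥0 in 𝓝 (y₀, 0), 2 * (p.2 : ℝ) - v p.1 < 0 := by
          have hc : Continuous fun p : G × ℝ≥0 => 2 * (p.2 : ℝ) - v p.1 := by fun_prop
          exact hc.continuousAt.eventually_lt continuousAt_const (by simpa using hpos)
        refine (continuous_fst.continuousAt (x := (y₀, (0 : ℝ≥0)))).congr ?_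
        filter_upwards [hlt] with p hp
        rw [hs p hp.le, h0]
    · have hsc : ContinuousAt s (y₀, w₀) := by
        refine continuous_projIcc.continuousAt.comp ?_
        have hc : Continuous fun p : G × ℝ≥0 => 2 * (p.2 : ℝ) - v p.1 := by fun_prop
        have hc' : Continuous fun p : G × ℝ≥0 => (p.2 : ℝ) := by fun_prop
        exact hc.continuousAt.div hc'.continuousAt (by simpa using hw)
      exact h.continuous.continuousAt.comp (continuousAt_fst.prodMk hsc)
  · exact NNReal.eq (congrArg (fun t : unitInterval => (t : ℝ)) ((hv' 1).2 rfl))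
  · intro y hy
    by_cases hy1 : y = 1
    · subst hy1; exact h1 1 rfl _
    have hne : (v y : ℝ) ≠ 0 := fun h => hy1 ((hv' y).1 (Subtype.ext h))
    have hs1 : s (y, ⟨v y, (v y).2.1⟩) = 1 := by
      have : (2 * (v y : ℝ) - v y) / v y = 1 := by field_simp; ring
      exact Set.projIcc_of_right_le _ this.ge
    change h (y, s (y, ⟨v y, (v y).2.1⟩)) = 1
    rw [hs1]
    exact hv1 y (Subtype.coe_lt_coe.1 (NNReal.coe_lt_coe.2 hy))

end KGroup

/-! ### Local slices and principal bundles -/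

section Slice

variable (G : Type u) [Group G] [TopologicalSpace G]

/-- `p : E → X` is the quotient map by the action of `G` on the `k`-space `E`. -/
structure IsOrbitMap {E X : Type u} [TopologicalSpace E] [TopologicalSpace X] [MulAction G E]
    (p : E → X) : Prop extends IsOpenQuotientMap p where
  isKSpace : IsKSpace E
  continuous_smul : Continuous fun q : Kify (G × E) => q.val.1 • q.val.2
  map_smul : ∀ (g : G) (e : E), p (g • e) = p e
  exists_smul_eq : ∀ e e' : E, p e = p e' → ∃ g : G, g • e = e'

/-- An open invariant subset `V` with an equivariant continuous map `r : V → G`. -/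
structure IsSlice {E : Type u} [TopologicalSpace E] [MulAction G E] (V : Set E) (r : E → G) :
    Prop where
  isOpen : IsOpen V
  smul_mem : ∀ (g : G), ∀ e ∈ V, g • e ∈ V
  map_smul : ∀ (g : G), ∀ e ∈ V, r (g • e) = g * r e
  continuousOn : ContinuousOn r V

variable {G}

lemma continuous_smul_kify {E : Type u} [TopologicalSpace E]
    [MulAction G E]
    (h : ∀ (K : Type u) [TopologicalSpace K] [CompactSpace K] [T2Space K] (α : K → G),
      Continuous α → Continuous fun q : E × K => α q.2 • q.1) :
    Continuous fun q : Kify (G × E) => q.val.1 • q.val.2 := by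
  rw [continuous_kify_iff]
  intro K a
  exact (h K _ (continuous_fst.comp a.continuous)).comp
    ((continuous_snd.comp a.continuous).prodMk continuous_id)

lemma IsSlice.preimage {E' E : Type u} [TopologicalSpace E'] [TopologicalSpace E] [MulAction G E']
    [MulAction G E] {V : Set E} {r : E → G} (hV : IsSlice G V r) {f : E' → E} (hf : Continuous f)
    (hfe : ∀ (g : G) (e : E'), f (g • e) = g • f e) : IsSlice G (f ⁻¹' V) (r ∘ f) where
  isOpen := hV.isOpen.preimage hf
  smul_mem g e he := by rw [Set.mem_preimage, hfe]; exact hV.smul_mem g _ he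
  map_smul g e he := by simp only [Function.comp, hfe]; exact hV.map_smul g _ he
  continuousOn := hV.continuousOn.comp hf.continuousOn fun _ h => h

variable {E X : Type u} [TopologicalSpace E] [TopologicalSpace X] [MulAction G E] {p : E → X}
  {V : Set E} {r : E → G}

lemma IsOrbitMap.continuous_smul_comp (hp : IsOrbitMap G p) {Z : Type u} [TopologicalSpace Z]
    [IsKSpace Z] {g : Z → G} {e : Z → E} (hg : Continuous g) (he : Continuous e) :
    Continuous fun z => g z • e z :=
  hp.continuous_smul.comp (continuous_kify_mk (hg.prodMk he))

lemma IsSlice.mem_of_map_eq (hV : IsSlice G V r) (hp : IsOrbitMap G p) {e e' : E} (he : e ∈ V)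
    (h : p e = p e') : e' ∈ V := by
  obtain ⟨g, rfl⟩ := hp.exists_smul_eq _ _ h
  exact hV.smul_mem g e he

lemma IsSlice.eq_of_map_eq (hV : IsSlice G V r) (hp : IsOrbitMap G p) {e e' : E} (he : e ∈ V)
    (h : p e = p e') (hr : r e = r e') : e = e' := by
  obtain ⟨g, rfl⟩ := hp.exists_smul_eq _ _ h
  rw [hV.map_smul g e he, eq_comm, mul_eq_right] at hr
  rw [hr, one_smul]

/-- A slice gives a section over its image: the map `e ↦ (r e)⁻¹ • e` is constant on orbits. -/
lemma IsSlice.exists_section [IsKGroup G] (hV : IsSlice G V r) (hp : IsOrbitMap G p) :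
    ∃ s : p '' V → E, Continuous s ∧ ∀ x, p (s x) = x ∧ s x ∈ V ∧ r (s x) = 1 := by
  have hU : IsOpen (p '' V) := hp.isOpenMap _ hV.isOpen
  have hpV : p ⁻¹' (p '' V) = V := Set.Subset.antisymm
    (fun e ⟨e', he', h⟩ => hV.mem_of_map_eq hp he' h) (Set.subset_preimage_image _ _)
  let P : p ⁻¹' (p '' V) → p '' V := (p '' V).restrictPreimage p
  have hP : IsQuotientMap P := hp.isQuotientMap.restrictPreimage_isOpen hU
  have hmem : ∀ e : p ⁻¹' (p '' V), (e : E) ∈ V := fun e => hpV.subset e.2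
  let c : p ⁻¹' (p '' V) → E := fun e => (r e)⁻¹ • (e : E)
  have hc : Continuous c := by
    have := hp.isKSpace
    have := isKSpace_of_isOpen (hU.preimage hp.continuous)
    refine hp.continuous_smul_comp (IsKGroup.continuous_inv.comp ?_) continuous_subtype_val
    exact hV.continuousOn.comp_continuous continuous_subtype_val hmem
  have hcP : ∀ e e', P e = P e' → c e = c e' := by
    intro e e' h
    obtain ⟨g, hg⟩ := hp.exists_smul_eq (e : E) (e' : E) (congrArg Subtype.val h)
    simp only [c, ← hg, hV.map_smul g e (hmem e), smul_smul]
    congr 1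
    group
  refine ⟨fun x => c (Function.surjInv hP.surjective x), ?_, fun x => ?_⟩
  · rw [hP.continuous_iff]
    convert hc using 1
    funext e
    exact hcP _ _ (Function.surjInv_eq hP.surjective (P e))
  · have hx := Function.surjInv_eq hP.surjective x
    refine ⟨?_, hV.smul_mem _ _ (hmem _), ?_⟩
    · rw [hp.map_smul]; exact congrArg Subtype.val hx
    · rw [hV.map_smul _ _ (hmem _), inv_mul_cancel]

/-- An orbit map with enough slices is a principal bundle. -/
lemma IsOrbitMap.isPrincipalBundle [IsKGroup G] (hp : IsOrbitMap G p)
    (h : ∀ e : E, ∃ V r, e ∈ V ∧ IsSlice G V r) : IsPrincipalBundle G p where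
  continuous := hp.continuous
  continuous_smul := hp.continuous_smul
  locally_trivial x := by
    obtain ⟨e, rfl⟩ := hp.surjective x
    obtain ⟨V, r, heV, hV⟩ := h e
    obtain ⟨s, hs, hs'⟩ := hV.exists_section hp
    have hU : IsOpen (p '' V) := hp.isOpenMap _ hV.isOpen
    have hmem : ∀ e : p ⁻¹' (p '' V), (e : E) ∈ V := fun ⟨e, e', he', h⟩ =>
      hV.mem_of_map_eq hp he' h
    have hps : ∀ (x : p '' V) (g : G), p (g • s x) = x := fun x g => by
      rw [hp.map_smul, (hs' x).1]
    have hrs : ∀ (x : p '' V) (g : G), r (g • s x) = g := fun x g => by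
      rw [hV.map_smul g _ (hs' x).2.1, (hs' x).2.2, mul_one]
    have := hp.isKSpace
    have := isKSpace_of_isOpen (hU.preimage hp.continuous)
    refine ⟨p '' V, hU, ⟨e, heV, rfl⟩,
      { toFun := fun q => ⟨q.val.2 • s q.val.1, by
          rw [Set.mem_preimage, hps]; exact q.val.1.2⟩
        invFun := fun e => Kify.mk (⟨p e, e.2⟩, r e)
        left_inv := fun q => ?_
        right_inv := fun e => ?_
        continuous_toFun := ?_
        continuous_invFun := ?_ }, fun y g => hps y g, fun y g k => mul_smul g k (s y)⟩
    · exact congrArg Kify.mk (Prod.ext (Subtype.ext (hps _ _)) (hrs _ _))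
    · refine Subtype.ext (hV.eq_of_map_eq hp (hV.smul_mem _ _ (hs' _).2.1) ?_ ?_)
      · exact hps ⟨p e, e.2⟩ (r e)
      · exact hrs ⟨p e, e.2⟩ (r e)
    · refine Continuous.subtype_mk ?_ _
      exact hp.continuous_smul_comp (continuous_snd.comp continuous_kify_val)
        (hs.comp (continuous_fst.comp continuous_kify_val))
    · refine continuous_kify_mk (Continuous.prodMk ?_ ?_)
      · exact (hp.continuous.comp continuous_subtype_val).subtype_mk _
      · exact hV.continuousOn.comp_continuous continuous_subtype_val hmem

/-- An equivariant map between orbit maps is a pullback of bundles if the target has enough slices: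
over a slice `(V, r)` with local section `s`, the inverse of the comparison map
is `(x, e) ↦ r e • s x`. -/
lemma IsOrbitMap.isBundlePullback [IsKGroup G] {E' X' : Type u} [TopologicalSpace E']
    [TopologicalSpace X'] [MulAction G E'] {p' : E' → X'} {f' : E' → E} {f : X' → X}
    (hp : IsOrbitMap G p) (hp' : IsOrbitMap G p')
    (h : ∀ e : E, ∃ V r, e ∈ V ∧ IsSlice G V r) (hf' : Continuous f')
    (equivariant : ∀ (g : G) (e : E'), f' (g • e) = g • f' e)
    (comm : ∀ e : E', f (p' e) = p (f' e)) : IsBundlePullback G f' p' p f where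
  equivariant := equivariant
  comm := comm
  isHomeomorph := by
    have := hp'.isKSpace
    let F : E' → KPullback f p := fun e => Kify.mk ⟨(p' e, f' e), comm e⟩
    have hF : Continuous F :=
      continuous_kify_mk ((hp'.continuous.prodMk hf').subtype_mk _)
    have hinj : Function.Injective F := by
      intro e e' hee
      have hee' : (p' e, f' e) = (p' e', f' e') := congrArg (fun q : KPullback f p => q.val.1) hee
      obtain ⟨h1, h2⟩ := Prod.ext_iff.1 hee'
      obtain ⟨V, r, heV, hV⟩ := h (f' e)
      exact (hV.preimage hf' equivariant).eq_of_map_eq hp' heV h1 (congrArg r h2)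
    have hsurj : Function.Surjective F := by
      intro q
      obtain ⟨⟨⟨x, e⟩, hxe⟩, rfl⟩ : ∃ q', Kify.mk q' = q := ⟨q.val, rfl⟩
      obtain ⟨e', rfl⟩ := hp'.surjective x
      obtain ⟨g, rfl⟩ := hp.exists_smul_eq (f' e') e ((comm e').symm.trans hxe)
      exact ⟨g • e', congrArg Kify.mk (Subtype.ext (Prod.ext (hp'.map_smul g e')
        (equivariant g e')))⟩
    let Φ : E' ≃ KPullback f p := Equiv.ofBijective F ⟨hinj, hsurj⟩
    suffices hinv : Continuous Φ.symm from (Φ.toHomeomorphOfContinuousOpen hF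
      (fun O hO => by rw [Φ.image_eq_preimage_symm]; exact hO.preimage hinv)).isHomeomorph
    rw [continuous_iff_continuousAt]
    intro q₀
    obtain ⟨V, r, hqV, hV⟩ := h q₀.val.1.2
    have hV' := hV.preimage hf' equivariant
    obtain ⟨s, hs, hs'⟩ := hV'.exists_section hp'
    have hq : Continuous fun q : KPullback f p => q.val.1 :=
      continuous_subtype_val.comp continuous_kify_val
    let W : Set (KPullback f p) := {q | q.val.1.2 ∈ V}
    have hW : IsOpen W := hV.isOpen.preimage (continuous_snd.comp hq)
    have hWmem : ∀ q : W, q.1.val.1.1 ∈ p' '' (f' ⁻¹' V) := by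
      rintro ⟨q, hqW⟩
      obtain ⟨e, rfl⟩ := hsurj q
      exact ⟨e, hqW, rfl⟩
    have := isKSpace_of_isOpen hW
    have hc : Continuous fun q : W => r q.1.val.1.2 • s ⟨q.1.val.1.1, hWmem q⟩ := by
      refine hp'.continuous_smul_comp ?_ (hs.comp ?_)
      · exact hV.continuousOn.comp_continuous
          (continuous_snd.comp (hq.comp continuous_subtype_val)) fun q => q.2
      · exact (continuous_fst.comp (hq.comp continuous_subtype_val)).subtype_mk _
    have heq : ∀ q : W, Φ.symm q = r q.1.val.1.2 • s ⟨q.1.val.1.1, hWmem q⟩ := by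
      rintro ⟨q, hqW⟩
      obtain ⟨e, rfl⟩ := hsurj q
      have he : Φ.symm (F e) = e := Φ.symm_apply_apply e
      simp only [he]
      refine hV'.eq_of_map_eq hp' hqW ?_ ?_
      · rw [hp'.map_smul, (hs' _).1]
        rfl
      · rw [hV'.map_smul _ _ (hs' _).2.1, (hs' _).2.2, mul_one]
        rfl
    have hcont : ContinuousOn Φ.symm W := by
      rw [continuousOn_iff_continuous_domRestrict]
      exact hc.congr fun q => (heq q).symm
    exact hcont.continuousAt (hW.mem_nhds hqV)

end Slice

/-! ### The simplicial spaces `Hom(L, G)` and their realizations -/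

section HomSpace

variable {G : Type u} [Group G] [TopologicalSpace G] {Γ : Type u} [Group Γ]

/-- A point of `Hom(Γ, G)` as a homomorphism. -/
def HomSpace.hom (ρ : HomSpace Γ G) : Γ →* G := Kify.val (Y := PtHom Γ G) ρ

lemma HomSpace.ext {ρ ρ' : HomSpace Γ G} (h : HomSpace.hom ρ = HomSpace.hom ρ') : ρ = ρ' :=
  DFunLike.ext (F := PtHom Γ G) _ _ (DFunLike.congr_fun h)

lemma HomSpace.hom_comap {Γ' : Type u} [Group Γ'] (φ : Γ →* Γ') (ρ : HomSpace Γ' G) :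
    (HomSpace.comap G φ ρ).hom = ρ.hom.comp φ := rfl

lemma HomSpace.continuous_eval (x : Γ) : Continuous fun ρ : HomSpace Γ G => ρ.hom x :=
  (continuous_apply x).comp ((continuous_induced_dom (f := fun (ρ : PtHom Γ G) (x : Γ) => ρ x)).comp
    (continuous_kify_val (Y := PtHom Γ G)))

lemma HomSpace.continuous_of_eval {Z : Type u} [TopologicalSpace Z] [IsKSpace Z]
    {f : Z → HomSpace Γ G} (hf : ∀ x, Continuous fun z => (f z).hom x) : Continuous f :=
  continuous_kify_mk (Y := PtHom Γ G) (f := fun z => (f z).val)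
    (continuous_induced_rng.2 (continuous_pi hf))

/-- The point of `Hom(⟨a_0⟩ ∗ Γ, G)` given by the value at `a_0` and the restriction to `Γ`. -/
def HomSpace.lift (g : G) (ρ : HomSpace Γ G) :
    HomSpace (Monoid.Coprod (FreeGroup PUnit.{u + 1}) Γ) G :=
  Kify.mk (Y := PtHom _ G) (liftHom g ρ.hom)

lemma HomSpace.hom_lift (g : G) (ρ : HomSpace Γ G) :
    (HomSpace.lift g ρ).hom = liftHom g ρ.hom := rfl

/-- A map to `Hom(⟨a_0⟩ ∗ Γ, G)` is continuous if its values at `a_0` and on `Γ` are. -/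
lemma HomSpace.continuous_lift [IsKGroup G] {Z : Type u} [TopologicalSpace Z] [IsKSpace Z]
    {g : Z → G} {ρ : Z → HomSpace Γ G} (hg : Continuous g) (hρ : Continuous ρ) :
    Continuous fun z => HomSpace.lift (g z) (ρ z) := by
  refine HomSpace.continuous_of_eval fun x => ?_
  simp only [HomSpace.hom_lift]
  have hmul := operationsContinuous_of_isKSpace (G := G) (Z := Z)
  induction x using Monoid.Coprod.induction_on with
  | inl x =>
    simp only [liftHom, Monoid.Coprod.lift_apply_inl]
    induction x using FreeGroup.induction_on with
    | C1 => simpa using continuous_const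
    | of x => simpa using hg
    | inv_of x _ =>
      simp only [map_inv, FreeGroup.lift_apply_of]
      exact IsKGroup.continuous_inv.comp hg
    | mul x y hx hy => simpa only [map_mul] using (hmul _ _ hx hy).1
  | inr x =>
    simp only [liftHom_inr]
    exact (HomSpace.continuous_eval x).comp hρ
  | mul x y hx hy => simpa only [map_mul] using (hmul _ _ hx hy).1

lemma HomSpace.lift_eval_comap
    (ρ : HomSpace (Monoid.Coprod (FreeGroup PUnit.{u + 1}) Γ) G) :
    HomSpace.lift (ρ.hom a₀) (HomSpace.comap G Monoid.Coprod.inr ρ) = ρ :=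
  HomSpace.ext (coprod_hom_ext (liftHom_a₀ _ _) (liftHom_inr _ _))

lemma HomSpace.translate_lift (g g' : G) (ρ : HomSpace Γ G) :
    translate g (HomSpace.lift g' ρ).hom = (HomSpace.lift (g * g') ρ).hom := by
  apply coprod_hom_ext <;> simp [translate, HomSpace.hom_lift]

lemma HomSpace.comap_inr_lift (g : G) (ρ : HomSpace Γ G) :
    HomSpace.comap G Monoid.Coprod.inr (HomSpace.lift g ρ) = ρ := by
  refine HomSpace.ext (MonoidHom.ext fun x => ?_)
  simp [HomSpace.hom_comap, HomSpace.hom_lift]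

lemma HomSpace.comap_liftHom_lift {Γ' : Type u} [Group Γ'] (φ : Γ →* Γ') (y : Γ') (g : G)
    (ρ : HomSpace Γ' G) :
    HomSpace.comap G (liftHom (a₀ * Monoid.Coprod.inr y) (Monoid.Coprod.inr.comp φ))
      (HomSpace.lift g ρ) = HomSpace.lift (g * ρ.hom y) (HomSpace.comap G φ ρ) := by
  refine HomSpace.ext ?_
  apply coprod_hom_ext <;> simp [HomSpace.hom_comap, HomSpace.hom_lift]

lemma HomSpace.comap_map_lift {Γ' : Type u} [Group Γ'] (φ : Γ →* Γ') (g : G)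
    (ρ : HomSpace Γ' G) :
    HomSpace.comap G (Monoid.Coprod.map (MonoidHom.id (FreeGroup PUnit.{u + 1})) φ)
      (HomSpace.lift g ρ) = HomSpace.lift g (HomSpace.comap G φ ρ) := by
  refine HomSpace.ext ?_
  apply coprod_hom_ext
  · change liftHom g ρ.hom a₀ = liftHom g _ a₀
    simp
  · simp [HomSpace.hom_comap, HomSpace.hom_lift]

end HomSpace

section Realization

variable {L M : CosimplicialObject GrpCat.{u}} {G : Type u} [Group G] [TopologicalSpace G]

/-- The point of `B(L, G)` represented by `ρ ∈ Hom(L_n, G)` and `t ∈ Δ^n`. -/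
def B.mk (n : SimplexCategory) (ρ : HomSpace (L.obj n) G) (t : SimplexCategory.toTop₀.obj n) :
    B L G :=
  Quot.mk (RealizationRel (homSpace L G)) ⟨n, ρ, t⟩

lemma B.mk_surjective (x : B L G) : ∃ n ρ t, B.mk n ρ t = x := by
  obtain ⟨⟨n, ρ, t⟩, rfl⟩ := Quot.exists_rep x
  exact ⟨n, ρ, t, rfl⟩

lemma B.mk_comap {m n : SimplexCategory} (θ : m ⟶ n) (ρ : HomSpace (L.obj n) G)
    (t : SimplexCategory.toTop₀.obj m) :
    B.mk m (HomSpace.comap G (L.map θ).hom ρ) t =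
      B.mk n ρ (SimplexCategory.toTop₀.map θ t) :=
  Quot.sound (RealizationRel.glue (X := homSpace L G) θ ρ t)

lemma B.isQuotientMap_mk :
    IsQuotientMap fun p : Σ n, HomSpace (L.obj n) G × (SimplexCategory.toTop₀.obj n : Type) =>
      B.mk p.1 p.2.1 p.2.2 :=
  isQuotientMap_quot_mk (r := RealizationRel (homSpace L G))

lemma B.continuous_mk (n : SimplexCategory) :
    Continuous fun p : HomSpace (L.obj n) G × (SimplexCategory.toTop₀.obj n : Type) =>
      B.mk n p.1 p.2 :=
  (continuous_sigma_iff.1 B.isQuotientMap_mk.continuous) n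

instance (n : SimplexCategory) : CompactSpace (SimplexCategory.toTop₀.obj n) :=
  inferInstanceAs (CompactSpace (stdSimplex ℝ (Fin (n.len + 1))))

instance (n : SimplexCategory) : T2Space (SimplexCategory.toTop₀.obj n) :=
  inferInstanceAs (T2Space (stdSimplex ℝ (Fin (n.len + 1))))

lemma B.isKSpace : IsKSpace (B L G) := by
  have : ∀ n, IsKSpace (HomSpace (L.obj n) G × (SimplexCategory.toTop₀.obj n : Type)) :=
    fun n => isKSpace_prod
  exact B.isQuotientMap_mk.isGeneratedBy

variable (b : Z1 L)

/-- The point of `B(L^b, G)` with coordinates `g` and `(ρ, t)`. -/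
def B.mkTwist (n : SimplexCategory) (g : G) (ρ : HomSpace (L.obj n) G)
    (t : SimplexCategory.toTop₀.obj n) : B (twist L b) G :=
  B.mk (L := twist L b) n (HomSpace.lift g ρ) t

lemma B.mkTwist_surjective (e : B (twist L b) G) : ∃ n g ρ t, B.mkTwist b n g ρ t = e := by
  obtain ⟨n, ρ, t, rfl⟩ := B.mk_surjective e
  exact ⟨n, _, _, t, congrArg (fun ρ => B.mk (L := twist L b) n ρ t)
    (HomSpace.lift_eval_comap (Γ := L.obj n) ρ)⟩

lemma B.smul_mkTwist (n : SimplexCategory) (g g' : G) (ρ : HomSpace (L.obj n) G)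
    (t : SimplexCategory.toTop₀.obj n) :
    g • B.mkTwist b n g' ρ t = B.mkTwist b n (g * g') ρ t :=
  congrArg (fun ρ => B.mk (L := twist L b) n ρ t) (HomSpace.translate_lift g g' ρ)

lemma B.comap_incl_mkTwist (n : SimplexCategory) (g : G) (ρ : HomSpace (L.obj n) G)
    (t : SimplexCategory.toTop₀.obj n) :
    B.comap (incl L b) G (B.mkTwist b n g ρ t) = B.mk n ρ t :=
  congrArg (fun ρ => B.mk (L := L) n ρ t) (HomSpace.comap_inr_lift g ρ)

/-- The coordinate `a_0` changes by the value of the cocycle under simplicial operators. -/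
lemma B.mkTwist_comap {m n : SimplexCategory} (θ : m ⟶ n) (g : G) (ρ : HomSpace (L.obj n) G)
    (t : SimplexCategory.toTop₀.obj m) :
    B.mkTwist b m (g * ρ.hom (b.val 0 (θ 0) (Fin.zero_le _)))
        (HomSpace.comap G (L.map θ).hom ρ) t =
      B.mkTwist b n g ρ (SimplexCategory.toTop₀.map θ t) :=
  (congrArg (fun ρ => B.mk (L := twist L b) m ρ t)
    (HomSpace.comap_liftHom_lift (L.map θ).hom _ g ρ).symm).trans
      (B.mk_comap (L := twist L b) θ (HomSpace.lift g ρ) t)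

lemma B.comap_twistMap_mkTwist (f : L ⟶ M) (n : SimplexCategory) (g : G)
    (ρ : HomSpace (M.obj n) G) (t : SimplexCategory.toTop₀.obj n) :
    B.comap (twistMap b f) G (B.mkTwist (b.map f) n g ρ t) =
      B.mkTwist b n g (HomSpace.comap G (f.app n).hom ρ) t :=
  congrArg (fun ρ => B.mk (L := twist L b) n ρ t) (HomSpace.comap_map_lift _ g ρ)

variable [IsKGroup G]

lemma B.continuous_mkTwist (n : SimplexCategory) (g : G) :
    Continuous fun p : HomSpace (L.obj n) G × (SimplexCategory.toTop₀.obj n : Type) =>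
      B.mkTwist b n g p.1 p.2 :=
  (B.continuous_mk (L := twist L b) n).comp
    ((HomSpace.continuous_lift continuous_const continuous_id).prodMap continuous_id)

/-- For compact `K`, the quotient map onto `B(L^b, G)` remains one after taking the product with
`K`, so continuity of the action may be checked on simplices. -/
lemma B.continuous_smul_of_compactSpace {K : Type u} [TopologicalSpace K] [CompactSpace K]
    [T2Space K] {α : K → G} (hα : Continuous α) :
    Continuous fun q : B (twist L b) G × K => α q.2 • q.1 := by
  refine B.isQuotientMap_mk.continuous_lift_prod_left ?_
  rw [← (Homeomorph.sigmaProdDistrib (X := fun n => HomSpace ((twist L b).obj n) G ×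
    (SimplexCategory.toTop₀.obj n : Type)) (Y := K)).symm.comp_continuous_iff',
    continuous_sigma_iff]
  intro n
  have hE : Continuous fun q : HomSpace ((twist L b).obj n) G × K =>
      HomSpace.lift (Γ := L.obj n) (α q.2 * q.1.hom a₀)
        (HomSpace.comap G Monoid.Coprod.inr q.1) := by
    refine continuous_prod_of_isKSpace _ fun K' c => ?_
    have : IsKSpace (K' × K) := inferInstanceAs (IsKSpace (CompHaus.of (K' × K)))
    have hc : Continuous fun q : K' × K => c q.1 := c.continuous.comp continuous_fst
    refine HomSpace.continuous_lift (operationsContinuous_of_isKSpace _ _ ?_ ?_).1 ?_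
    · exact hα.comp continuous_snd
    · exact (HomSpace.continuous_eval (Γ := (twist L b).obj n) _).comp hc
    · exact (HomSpace.comap G _).continuous.comp hc
  refine ((B.continuous_mk (L := twist L b) n).comp ((hE.comp
    ((continuous_fst.comp continuous_fst).prodMk continuous_snd)).prodMk
      (continuous_snd.comp continuous_fst))).congr ?_
  rintro ⟨⟨ρ, t⟩, k⟩
  have := B.smul_mkTwist b n (α k) (HomSpace.hom (Γ := (twist L b).obj n) ρ a₀)
    (HomSpace.comap G Monoid.Coprod.inr ρ) t
  refine this.symm.trans ?_
  exact congrArg (fun ρ => α k • B.mk (L := twist L b) n ρ t)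
    (HomSpace.lift_eval_comap (Γ := L.obj n) ρ)

/-- `B(L, G)` is the orbit space of `B(L^b, G)`. -/
lemma B.isOrbitMap : IsOrbitMap G (B.comap (incl L b) G) := by
  have : IsKSpace (B (twist L b) G) := B.isKSpace
  have hsmul : ∀ (g : G) (e : B (twist L b) G),
      B.comap (incl L b) G (g • e) = B.comap (incl L b) G e := fun g e => by
    obtain ⟨n, g', ρ, t, rfl⟩ := B.mkTwist_surjective b e
    rw [B.smul_mkTwist, B.comap_incl_mkTwist, B.comap_incl_mkTwist]
  have hcont : ∀ g : G, Continuous fun e : B (twist L b) G => g • e := fun g =>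
    (B.continuous_smul_of_compactSpace b (K := PUnit.{u + 1}) (α := fun _ => g)
      continuous_const).comp (continuous_id.prodMk (continuous_const (y := PUnit.unit)))
  -- the simplexwise sections with `a_0`-coordinate `1` define an inverse on orbits
  have hexists : ∀ e e' : B (twist L b) G,
      B.comap (incl L b) G e = B.comap (incl L b) G e' → ∃ g : G, g • e = e' := by
    let Ψ : B L G → MulAction.orbitRel.Quotient G (B (twist L b) G) :=
      Quot.lift (fun p => Quotient.mk _ (B.mkTwist b p.1 1 p.2.1 p.2.2)) (by
        rintro _ _ ⟨θ, ρ, t⟩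
        refine Quotient.sound
          ⟨(HomSpace.hom (Γ := L.obj _) ρ (b.val 0 (θ 0) (Fin.zero_le _)))⁻¹, ?_⟩
        refine (congrArg _ (B.mkTwist_comap b θ 1 ρ t).symm).trans ?_
        refine (B.smul_mkTwist _ _ _ _ _ _).trans ?_
        rw [one_mul, inv_mul_cancel]
        rfl)
    have hΨ : ∀ e, Ψ (B.comap (incl L b) G e) = Quotient.mk _ e := fun e => by
      obtain ⟨n, g, ρ, t, rfl⟩ := B.mkTwist_surjective b e
      rw [B.comap_incl_mkTwist]
      refine Quotient.sound ⟨g⁻¹, ?_⟩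
      exact (B.smul_mkTwist _ _ _ _ _ _).trans (by rw [inv_mul_cancel])
    intro e e' h
    have := (hΨ e').symm.trans ((congrArg Ψ h).symm.trans (hΨ e))
    exact Quotient.exact this
  have hquot : IsQuotientMap (B.comap (incl L b) G) := by
    have hs : Continuous fun p : Σ n, HomSpace (L.obj n) G ×
        (SimplexCategory.toTop₀.obj n : Type) => B.mkTwist b p.1 1 p.2.1 p.2.2 :=
      continuous_sigma fun n => B.continuous_mkTwist b n 1
    refine IsQuotientMap.of_comp hs (ContinuousMap.continuous _) ?_
    convert B.isQuotientMap_mk (L := L) (G := G) using 1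
    funext p
    exact B.comap_incl_mkTwist b p.1 1 p.2.1 p.2.2
  refine ⟨⟨hquot.surjective, hquot.continuous, fun O hO => ?_⟩, this,
    continuous_smul_kify fun _ _ _ _ _ hα => B.continuous_smul_of_compactSpace b hα,
    hsmul, hexists⟩
  rw [← hquot.isOpen_preimage]
  have : B.comap (incl L b) G ⁻¹' (B.comap (incl L b) G '' O) =
      ⋃ g : G, (fun e => g • e) ⁻¹' O := by
    ext e
    simp only [Set.mem_preimage, Set.mem_image, Set.mem_iUnion]
    constructor
    · rintro ⟨e', he', h⟩
      obtain ⟨g, rfl⟩ := hexists e e' h.symm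
      exact ⟨g, he'⟩
    · rintro ⟨g, hg⟩
      exact ⟨_, hg, hsmul g e⟩
  rw [this]
  exact isOpen_iUnion fun g => hO.preimage (hcont g)

end Realization

/-! ### Points of `EG` as weighted sequences, and slices of `EG` -/

/-- The barycentric coordinates of a point of `Δ^n`. -/
def simplexCoord {n : SimplexCategory} (t : SimplexCategory.toTop₀.obj n)
    (i : Fin (n.len + 1)) : ℝ≥0 :=
  ⟨(show stdSimplex ℝ (Fin (n.len + 1)) from t) i, stdSimplex.zero_le _ i⟩

lemma continuous_simplexCoord {n : SimplexCategory} (i : Fin (n.len + 1)) :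
    Continuous fun t : SimplexCategory.toTop₀.obj n => simplexCoord t i :=
  ((continuous_apply i).comp
    (continuous_subtype_val (p := (· ∈ stdSimplex ℝ (Fin (n.len + 1)))))).subtype_mk _

lemma exists_simplexCoord_ne_zero {n : SimplexCategory} (t : SimplexCategory.toTop₀.obj n) :
    ∃ i, simplexCoord t i ≠ 0 := by
  by_contra! h
  have h1 : ∑ i, (simplexCoord t i : ℝ) = 1 :=
    stdSimplex.sum_eq_one (show stdSimplex ℝ (Fin (n.len + 1)) from t)
  rw [Finset.sum_eq_zero fun i _ => congrArg NNReal.toReal (h i)] at h1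
  exact zero_ne_one h1

lemma simplexCoord_map {m n : SimplexCategory} (θ : m ⟶ n) (t : SimplexCategory.toTop₀.obj m)
    (j : Fin (n.len + 1)) :
    simplexCoord (SimplexCategory.toTop₀.map θ t) j =
      ∑ i : Fin (m.len + 1), if θ i = j then simplexCoord t i else 0 := by
  apply NNReal.coe_injective
  refine (FunOnFinite.linearMap_apply_apply ℝ ℝ θ _ j).trans ?_
  rw [Finset.sum_filter, NNReal.coe_sum]
  exact Finset.sum_congr rfl fun i _ => by split_ifs <;> rfl

lemma liftHom_a₀_mul_inr {Γ Γ' : Type u} [Group Γ] [Group Γ'] (φ : Γ →* Γ') (y : Γ') (x : Γ) :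
    liftHom (a₀ * Monoid.Coprod.inr y) (Monoid.Coprod.inr.comp φ) (a₀ * Monoid.Coprod.inr x) =
      a₀ * Monoid.Coprod.inr (y * φ x) := by
  simp [mul_assoc]

/-- The elements `a_0 a_1 ⋯ a_i` of `F^+_n`. -/
def vertexElt (n i : ℕ) :
    Monoid.Coprod (FreeGroup PUnit.{u + 1}) (FreeGroup (ULift.{u} (Fin n))) :=
  a₀ * Monoid.Coprod.inr (initProd n i)

/-- In terms of the elements `a_0 a_1 ⋯ a_i`, the operators of `F^+` are given by reindexing. -/
lemma twistOp_vertexElt {m n : SimplexCategory} (θ : m ⟶ n) (i : Fin (m.len + 1)) :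
    twistOp free.{u} a₁ θ (vertexElt m.len i) = vertexElt n.len (θ i) := by
  have hval : a₁.{u}.val 0 (θ 0) (Fin.zero_le _) = initProd.{u} n.len (θ 0) := by
    refine (freeMap_gen.{u} _ (0 : Fin 1)).trans ?_
    change (initProd n.len 0)⁻¹ * initProd n.len (θ 0) = _
    simp [initProd]
  have hmap : free.{u}.map θ (initProd.{u} m.len i) =
      (initProd.{u} n.len (θ 0))⁻¹ * initProd.{u} n.len (θ i) := freeMap_initProd _ i
  refine (liftHom_a₀_mul_inr (free.{u}.map θ).hom _ _).trans ?_
  refine congrArg (fun x => a₀ * Monoid.Coprod.inr x) ((congrArg₂ (· * ·) hval hmap).trans ?_)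
  exact mul_inv_cancel_left _ _

section EG

variable {G : Type u} [Group G] [TopologicalSpace G]

/-- The weighted sequence of a representative of a point of `EG`: the points are the values on
`a_0 a_1 ⋯ a_i`, and the weights are the barycentric coordinates. -/
def vertexSeq (n : SimplexCategory) (ρ : HomSpace ((twist free.{u} a₁).obj n) G)
    (t : SimplexCategory.toTop₀.obj n) : List (G × ℝ≥0) :=
  (List.finRange (n.len + 1)).map fun i : Fin (n.len + 1) =>
    (ρ.hom (vertexElt n.len i), simplexCoord t i)

lemma normalForm_vertexSeq_comap {m n : SimplexCategory} (θ : m ⟶ n)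
    (ρ : HomSpace ((twist free.{u} a₁).obj n) G) (t : SimplexCategory.toTop₀.obj m) :
    normalForm (vertexSeq m (HomSpace.comap G ((twist free.{u} a₁).map θ).hom ρ) t) =
      normalForm (vertexSeq n ρ (SimplexCategory.toTop₀.map θ t)) := by
  have h₁ : vertexSeq m (HomSpace.comap G ((twist free.{u} a₁).map θ).hom ρ) t =
      (List.finRange (m.len + 1)).map fun i : Fin (m.len + 1) =>
        (ρ.hom (vertexElt n.len (θ i)), simplexCoord t i) :=
    List.map_congr_left fun i _ => Prod.ext (congrArg ρ.hom (twistOp_vertexElt θ i)) rfl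
  rw [h₁]
  refine (normalForm_map_fiber (fun i : Fin (m.len + 1) => θ i)
    (fun j : Fin (n.len + 1) => ρ.hom (vertexElt n.len j)) (simplexCoord t)
    (List.finRange (n.len + 1)) (List.pairwise_lt_finRange _) (List.finRange (m.len + 1))
    ((List.pairwise_le_finRange _).imp fun h => θ.toOrderHom.monotone h)
    fun i _ => List.mem_finRange _).trans ?_
  refine congrArg normalForm (List.map_congr_left fun j _ => Prod.ext rfl ?_)
  rw [simplexCoord_map, Fin.sum_univ_def]

/-- The normal form of a point of `EG`. -/
noncomputable def pointSeq : EG G → List (G × ℝ≥0) :=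
  Quot.lift (fun p => normalForm (vertexSeq p.1 p.2.1 p.2.2)) (by
    rintro _ _ ⟨θ, ρ, t⟩
    exact normalForm_vertexSeq_comap θ ρ t)

lemma pointSeq_smul (g : G) (e : EG G) : pointSeq (g • e) = translateSeq g (pointSeq e) := by
  obtain ⟨n, g', ρ, t, rfl⟩ := B.mkTwist_surjective a₁ e
  rw [B.smul_mkTwist]
  refine Eq.trans ?_ (translateSeq_normalForm g (vertexSeq n (HomSpace.lift g' ρ) t))
  refine congrArg normalForm ?_
  unfold translateSeq vertexSeq
  rw [List.map_map]
  refine List.map_congr_left fun i _ => Prod.ext ?_ rfl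
  have h : ∀ g : G, (HomSpace.lift g ρ).hom (vertexElt n.len i) =
      g * ρ.hom (initProd n.len i) := fun g =>
    (map_mul (HomSpace.lift g ρ).hom _ _).trans
      (congrArg₂ (· * ·) (liftHom_a₀ _ _) (liftHom_inr _ _ _))
  exact (h _).trans ((mul_assoc _ _ _).trans (congrArg (g * ·) (h g').symm))

lemma normalForm_pointSeq (e : EG G) : normalForm (pointSeq e) = pointSeq e := by
  obtain ⟨n, ρ, t, rfl⟩ := B.mk_surjective e
  exact normalForm_normalForm _

lemma pointSeq_ne_nil (e : EG G) : pointSeq e ≠ [] := by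
  obtain ⟨n, ρ, t, rfl⟩ := B.mk_surjective e
  obtain ⟨i, hi⟩ := exists_simplexCoord_ne_zero t
  intro h
  exact hi (eq_zero_of_normalForm_eq_nil h _ (List.mem_map.2 ⟨i, List.mem_finRange _, rfl⟩))

variable [IsKGroup G] [T2Space G]

/-- Over the simplices of `EG`, the weighted sequences form continuous families. -/
lemma isOpen_reduces (C : Contraction G) (n : ℕ) {O : Set G} (hO : IsOpen O) :
    IsOpen {e : EG G | ∃ g ∈ O, C.Reduces n (pointSeq e) g} := by
  rw [← (B.isQuotientMap_mk (L := twist free.{u} a₁) (G := G)).isOpen_preimage,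
    isOpen_sigma_iff]
  intro m
  let Z := HomSpace ((twist free.{u} a₁).obj m) G × (SimplexCategory.toTop₀.obj m : Type)
  have hZ : IsKSpace Z := isKSpace_prod
  let φ : List (C(Z, G) × C(Z, ℝ≥0)) := (List.finRange (m.len + 1)).map fun i : Fin (m.len + 1) =>
    (⟨fun z => z.1.hom (vertexElt m.len i), (HomSpace.continuous_eval _).comp continuous_fst⟩,
      ⟨fun z => simplexCoord z.2 i, (continuous_simplexCoord i).comp continuous_snd⟩)
  have hφ : ∀ z, evalSeq φ z = vertexSeq m z.1 z.2 := fun z => List.map_map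
  rw [isOpen_iff_eventually]
  rintro z ⟨g, hg, h⟩
  have h' : C.Reduces n (evalSeq φ z) g := by
    rw [hφ]
    exact h.congr (normalForm_normalForm _)
  filter_upwards [h'.eventually operationsContinuous_of_isKSpace φ (hO.mem_nhds hg)] with w hw
  obtain ⟨g', hg', hr⟩ := hw
  rw [hφ] at hr
  exact ⟨g', hg', hr.congr (normalForm_normalForm _).symm⟩

/-- The points whose normal form reduces to one of a fixed length form the domain of a slice. Every
point lies in one, for the length of its own normal form. -/
lemma exists_slice (C : Contraction G) (e : EG G) : ∃ V r, e ∈ V ∧ IsSlice G V r := by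
  classical
  obtain ⟨p, l, hl⟩ := List.exists_cons_of_ne_nil (pointSeq_ne_nil e)
  let V : Set (EG G) := {e | ∃ g, C.Reduces l.length (pointSeq e) g}
  let r : EG G → G := fun e => if h : e ∈ V then h.choose else 1
  have hr : ∀ e ∈ V, C.Reduces l.length (pointSeq e) (r e) := fun e he => by
    simp only [r, dif_pos he]
    exact he.choose_spec
  have hr' : ∀ e g, C.Reduces l.length (pointSeq e) g → r e = g := fun e g h =>
    (hr e ⟨g, h⟩).unique h
  refine ⟨V, r, ⟨p.1, .base ((normalForm_pointSeq e).trans hl) rfl⟩, ?_, ?_, ?_, ?_⟩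
  · simpa [V] using isOpen_reduces C l.length isOpen_univ
  · rintro g e ⟨k, hk⟩
    exact ⟨g * k, pointSeq_smul g e ▸ hk.translate g⟩
  · intro g e he
    exact hr' _ _ (pointSeq_smul g e ▸ (hr e he).translate g)
  · intro e he O hO
    obtain ⟨O', hO'O, hO', heO'⟩ := mem_nhds_iff.1 hO
    refine mem_nhdsWithin_of_mem_nhds ?_
    filter_upwards [(isOpen_reduces C l.length hO').mem_nhds ⟨r e, heO', hr e he⟩] with e' he'
    obtain ⟨g, hg, h⟩ := he'
    exact hO'O (hr' e' g h ▸ hg)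

end EG

end CosGrp

theorem mainTheorem9 (G : Type u) [Group G] [TopologicalSpace G] [CompactlyGeneratedSpace G]
    [CosGrp.IsKGroup G] (hG : CosGrp.WellBased G)
    (L : CategoryTheory.CosimplicialObject GrpCat.{u}) (hL : CosGrp.FinitelyGenerated L)
    (h : CosGrp.free.{u} ⟶ L) :
    CosGrp.IsPrincipalBundle G (CosGrp.B.comap (CosGrp.incl L (CosGrp.cocycle h)) G) ∧
    CosGrp.IsBundlePullback G
      (CosGrp.B.comap (CosGrp.twistMap CosGrp.a₁ h) G :
        CosGrp.B (CosGrp.twist L (CosGrp.cocycle h)) G → CosGrp.EG G)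
      (CosGrp.B.comap (CosGrp.incl L (CosGrp.cocycle h)) G)
      (CosGrp.EGproj G)
      (CosGrp.B.comap h G) := by
  have : T2Space G := CosGrp.t2Space_of_wellBased hG
  obtain ⟨C⟩ := CosGrp.exists_contraction hG
  have hp : CosGrp.IsOrbitMap G (CosGrp.EGproj G) := CosGrp.B.isOrbitMap CosGrp.a₁
  have hp' := CosGrp.B.isOrbitMap (G := G) (CosGrp.cocycle h)
  have hequiv : ∀ (g : G) (e : CosGrp.B (CosGrp.twist L (CosGrp.cocycle h)) G),
      CosGrp.B.comap (CosGrp.twistMap CosGrp.a₁ h) G (g • e) =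
        g • CosGrp.B.comap (CosGrp.twistMap CosGrp.a₁ h) G e := fun g e => by
    obtain ⟨n, k, ρ, t, rfl⟩ := CosGrp.B.mkTwist_surjective _ e
    refine (congrArg _ (CosGrp.B.smul_mkTwist _ n g k ρ t)).trans ?_
    refine (CosGrp.B.comap_twistMap_mkTwist CosGrp.a₁ h n _ ρ t).trans ?_
    refine Eq.trans ?_ (congrArg _ (CosGrp.B.comap_twistMap_mkTwist CosGrp.a₁ h n k ρ t)).symm
    exact (CosGrp.B.smul_mkTwist _ n g k _ t).symm
  have hcomm : ∀ e : CosGrp.B (CosGrp.twist L (CosGrp.cocycle h)) G,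
      CosGrp.B.comap h G (CosGrp.B.comap (CosGrp.incl L (CosGrp.cocycle h)) G e) =
        CosGrp.EGproj G (CosGrp.B.comap (CosGrp.twistMap CosGrp.a₁ h) G e) := fun e => by
    obtain ⟨n, k, ρ, t, rfl⟩ := CosGrp.B.mkTwist_surjective _ e
    refine (congrArg _ (CosGrp.B.comap_incl_mkTwist _ n k ρ t)).trans ?_
    refine Eq.trans ?_ (congrArg _ (CosGrp.B.comap_twistMap_mkTwist CosGrp.a₁ h n k ρ t)).symm
    exact (CosGrp.B.comap_incl_mkTwist _ n k _ t).symm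
  have hcont := (CosGrp.B.comap (CosGrp.twistMap CosGrp.a₁ h) G).continuous
  refine ⟨hp'.isPrincipalBundle fun e => ?_,
    hp.isBundlePullback hp' (CosGrp.exists_slice C) hcont hequiv hcomm⟩
  obtain ⟨V, r, he, hV⟩ := CosGrp.exists_slice C (CosGrp.B.comap (CosGrp.twistMap CosGrp.a₁ h) G e)
  exact ⟨_, _, he, hV.preimage hcont hequiv⟩
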